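/- **Theorem (Berry–Esseen inequality).** Let $n\in\mathbb N$ and let $X_1,\dots,X_n$ be independent real random variables on a probability space with $\mathbf E X_k=0$ and $\mathbf E|X_k|^3<\infty$ for $k=1,\dots,n$. Put $$S_n=\sum_{k=1}^n X_k,\qquad B_n^2=\sum_{k=1}^n \mathbf E X_k^2=\mathbf D S_n,\qquad L^3=\frac1{B_n^3}\sum_{k=1}^n\mathbf E|X_k|^3,$$ and assume $B_n^2>0$, $B_n=\sqrt{B_n^2}$. Let $\Phi$ be the distribution function of the standard normal law. Then $$\Delta_n:=\sup_{x\in\mathbb R}\bigl|\mathbf P(S_n<xB_n)-\Phi(x)\bigr|\le C_0L^3,$$ with the absolute constant $$C_0=\frac{2}{\sqrt{2\pi}}\,\inf\left\{\frac{b}{(1-2d/3)^{3/2}}+\frac{2b(b+1)}{\pi d(b-1)}\;:\;b>1,\ d\in\left(0,\tfrac32\right)\right\}.$$ In particular, taking $b=2$ and $d=3/4$, $$C_0\le\frac{2}{\sqrt{2\pi}}\left(4\sqrt2+\frac{48}{3\pi}\right)=\frac{8}{\sqrt{2\pi}}\left(\sqrt2+\frac4\pi\right)=8.57\ldots<9.$$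 Moreover the infimum is attained at exactly one pair $(b,d)$, for which $b=1.72\ldots$ and $d=0.703\ldots$, and correspondingly $C_0=8.23\ldots$ (decimal expansions truncated after the digits shown). -/

import Mathlib

open MeasureTheory ProbabilityTheory

universe u

noncomputable section

namespace BerryEsseen

/-- The distribution function `Φ` of the standard normal law. -/
def stdNormalCDF (x : ℝ) : ℝ := cdf (gaussianReal 0 1) x

variable {Ω : Type*} [MeasurableSpace Ω]

/-- The sum `S_n = X_1 + ⋯ + X_n`. -/
def partialSum {n : ℕ} (X : Fin n → Ω → ℝ) (ω : Ω) : ℝ := ∑ k, X k ω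

/-- `B_n² = ∑ σ_k²` with `σ_k² = E X_k²` (the variance of `S_n` for independent centred `X_k`). -/
def varSum {n : ℕ} (P : Measure Ω) (X : Fin n → Ω → ℝ) : ℝ := ∑ k, ∫ ω, X k ω ^ 2 ∂P

/-- `B_n`, the nonnegative square root of `B_n²`. -/
def normalizer {n : ℕ} (P : Measure Ω) (X : Fin n → Ω → ℝ) : ℝ := √(varSum P X)

/-- The Lyapunov ratio of order three, `L³ = B_n⁻³ ∑ E |X_k|³`. -/
def lyapunovRatio {n : ℕ} (P : Measure Ω) (X : Fin n → Ω → ℝ) : ℝ :=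
  1 / normalizer P X ^ 3 * ∑ k, ∫ ω, |X k ω| ^ 3 ∂P

/-- `Δ_n = sup_x |P(S_n < x B_n) - Φ(x)|`. The values under the supremum lie in `[0, 1]`. -/
def kolmogorovDist {n : ℕ} (P : Measure Ω) (X : Fin n → Ω → ℝ) : ℝ :=
  ⨆ x : ℝ, |P.real {ω | partialSum X ω < x * normalizer P X} - stdNormalCDF x|

/-- The set of parameters `(b, d)` with `b > 1` and `d ∈ (0, 3/2)`. -/
def paramSet : Set (ℝ × ℝ) := {q | 1 < q.1 ∧ 0 < q.2 ∧ q.2 < 3 / 2}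

/-- `b / (1 - 2d/3)^{3/2} + 2b(b+1) / (π d (b-1))` at `q = (b, d)`. -/
def objective (q : ℝ × ℝ) : ℝ :=
  q.1 / (1 - 2 * q.2 / 3) ^ (3 / 2 : ℝ)
    + 2 * q.1 * (q.1 + 1) / (Real.pi * q.2 * (q.1 - 1))

/-- The constant `C₀`. The infimum is over a nonempty set of positive reals. -/
def C₀ : ℝ := 2 / √(2 * Real.pi) * sInf (objective '' paramSet)

end BerryEsseen

end

/-! The inequality is proved with the smaller constant 4/√π + 36/(π√(2π)), about 6.83, and the
infimum defining `C₀` enters it only through the bound 8.23 ≤ `C₀`. The proof thus has two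
independent halves.

Optimisation. With c = b - 1, A = (1 - 2d/3)^(-3/2) and E = 2/(πd), the objective is cA + A + cE +
3E + 2E/c. In the coordinates log c and log d each term is the exponential of a convex function, so
tangent lines at a critical point show that it is the unique global minimum
(`objective_lt_of_critical`). Eliminating d from the critical equations leaves one equation in c,
solved by the intermediate value theorem on a short interval (`exists_critical_equation`); numerical
bounds on the minimum follow.

Probability. Taylor expansion and a telescoping product bound the difference between the
characteristic function of the sum and the Gaussian one (`norm_charFun_sum_sub_gaussian_le`).
Averaging against the Fejér kernel, whose Fourier transform lives on [-1, 1], turns this into a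
bound for smoothed distribution functions (`abs_integral_fejer_mul_sub_le`). The smoothing is undone
because one distribution function is increasing and the other Lipschitz
(`abs_measureReal_Iio_sub_le`). Rescaling the sum by a multiple of 1/L³, in the notation of the
theorem, balances the two error terms, making both proportional to the Lyapunov ratio. -/

namespace BerryEsseen

/-! ### The minimisation problem behind `C₀` and its numerical values -/

/-- Gibbs' inequality for two-point distributions, in the form of a lower bound for
`log ((1 - x₀) / (1 - x))`. -/
lemma div_one_sub_mul_log_le {x x₀ : ℝ} (hx : 0 < x) (hx1 : x < 1) (hx₀ : 0 < x₀) (hx₀1 : x₀ < 1) :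
    x₀ / (1 - x₀) * Real.log (x / x₀) ≤ Real.log ((1 - x₀) / (1 - x)) := by
  have h1 : 0 < 1 - x := by linarith
  have h2 : 0 < 1 - x₀ := by linarith
  have e1 := Real.log_le_sub_one_of_pos (div_pos hx hx₀)
  have e2 := Real.log_le_sub_one_of_pos (div_pos h1 h2)
  have e3 : Real.log ((1 - x₀) / (1 - x)) = -Real.log ((1 - x) / (1 - x₀)) := by
    rw [← Real.log_inv, inv_div]
  have e4 : x₀ * Real.log (x / x₀) ≤ x - x₀ := by
    calc _ ≤ x₀ * (x / x₀ - 1) := by gcongr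
      _ = _ := by field_simp
  have e5 : (1 - x₀) * Real.log ((1 - x) / (1 - x₀)) ≤ x₀ - x := by
    calc _ ≤ (1 - x₀) * ((1 - x) / (1 - x₀) - 1) := by gcongr
      _ = _ := by field_simp; ring
  rw [e3, div_mul_eq_mul_div, div_le_iff₀ h2]
  linarith

/-- Partial fractions in b - 1 leave five positive terms, each a product of powers of b - 1, d and 1
- 2d/3, which is the form needed for logarithmic coordinates. -/
lemma objective_eq {b d : ℝ} (hb : 1 < b) (hd : 0 < d) :
    objective (b, d) = (b - 1) * (1 / (1 - 2 * d / 3) ^ (3 / 2 : ℝ))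
      + 1 / (1 - 2 * d / 3) ^ (3 / 2 : ℝ) + (b - 1) * (2 / (Real.pi * d))
      + 3 * (2 / (Real.pi * d)) + 2 * (2 / (Real.pi * d) / (b - 1)) := by
  have hb' : b - 1 ≠ 0 := by linarith
  have := Real.pi_pos.ne'
  have := hd.ne'
  simp only [objective]
  generalize (1 - 2 * d / 3) ^ (3 / 2 : ℝ) = A
  have : 2 * b * (b + 1) / (Real.pi * d * (b - 1)) = (b - 1) * (2 / (Real.pi * d))
      + 3 * (2 / (Real.pi * d)) + 2 * (2 / (Real.pi * d) / (b - 1)) := by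
    field_simp
    ring
  rw [this]
  ring

/-- A critical point of the objective is its unique global minimum: in logarithmic coordinates
the objective is a sum of exponentials of convex functions. -/
lemma objective_lt_of_critical {c₀ d₀ : ℝ} (hc₀ : 0 < c₀) (hd₀ : 0 < d₀) (hd₀' : d₀ < 3 / 2)
    (h1 : 1 / (1 - 2 * d₀ / 3) ^ (3 / 2 : ℝ) = 2 / (Real.pi * d₀) * (2 / c₀ ^ 2 - 1))
    (h2 : 1 / (1 - 2 * d₀ / 3) ^ (3 / 2 : ℝ) * (d₀ / (1 - 2 * d₀ / 3))
      = 2 / (Real.pi * d₀) * ((c₀ + 2) / c₀))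
    {q : ℝ × ℝ} (hq : q ∈ paramSet) (hne : q ≠ (c₀ + 1, d₀)) :
    objective (c₀ + 1, d₀) < objective q := by
  obtain ⟨b, d⟩ := q
  obtain ⟨hb, hd, hd'⟩ := hq
  simp only at hb hd hd'
  rw [objective_eq hb hd, objective_eq (by linarith) hd₀]
  obtain ⟨c, hc, rfl⟩ : ∃ c, 0 < c ∧ b = c + 1 := ⟨b - 1, by linarith, by ring⟩
  simp only [add_sub_cancel_right]
  have hpi := Real.pi_pos
  have hy : 0 < 1 - 2 * d / 3 := by linarith
  have hy₀ : 0 < 1 - 2 * d₀ / 3 := by linarith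
  obtain ⟨u, hu⟩ : ∃ u, u = Real.log (c / c₀) := ⟨_, rfl⟩
  obtain ⟨v, hv⟩ : ∃ v, v = Real.log (d / d₀) := ⟨_, rfl⟩
  have hcu : c = c₀ * Real.exp u := by rw [hu, Real.exp_log (by positivity)]; field_simp
  have hdv : d = d₀ * Real.exp v := by rw [hv, Real.exp_log (by positivity)]; field_simp
  -- p is the slope of -log(1 - 2d/3) as a function of log d at d₀; convexity of that function is
  -- the Gibbs bound below.
  obtain ⟨p, hp⟩ : ∃ p, p = (2 * d₀ / 3) / (1 - 2 * d₀ / 3) := ⟨_, rfl⟩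
  have hgibbs : p * v ≤ Real.log ((1 - 2 * d₀ / 3) / (1 - 2 * d / 3)) := by
    have := div_one_sub_mul_log_le (x := 2 * d / 3) (x₀ := 2 * d₀ / 3) (by positivity)
      (by linarith) (by positivity) (by linarith)
    rw [hp, hv]
    convert this using 3
    field_simp
  set A₀ := 1 / (1 - 2 * d₀ / 3) ^ (3 / 2 : ℝ) with hA₀
  set A := 1 / (1 - 2 * d / 3) ^ (3 / 2 : ℝ) with hA
  have hA₀pos : 0 < A₀ := by positivity
  have hAA : A₀ * Real.exp (3 / 2 * (p * v)) ≤ A := by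
    have : A = A₀ * Real.exp (3 / 2 * Real.log ((1 - 2 * d₀ / 3) / (1 - 2 * d / 3))) := by
      rw [mul_comm (3 / 2 : ℝ), ← Real.rpow_def_of_pos (by positivity), Real.div_rpow hy₀.le hy.le,
        hA₀, hA]
      rw [one_div_mul_eq_div, div_div_cancel_left' (by positivity), one_div]
    rw [this]
    gcongr
  set E₀ := 2 / (Real.pi * d₀) with hE₀
  have hE₀pos : 0 < E₀ := by positivity
  have hE : 2 / (Real.pi * d) = E₀ * Real.exp (-v) := by
    rw [hE₀, hdv, Real.exp_neg]; field_simp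
  have t1 : c₀ * A₀ * (1 + u + 3 / 2 * (p * v)) ≤ c * A := by
    calc _ ≤ c₀ * A₀ * Real.exp (u + 3 / 2 * (p * v)) := by
          gcongr
          linarith [Real.add_one_le_exp (u + 3 / 2 * (p * v))]
      _ = c * (A₀ * Real.exp (3 / 2 * (p * v))) := by rw [hcu, Real.exp_add]; ring
      _ ≤ _ := by gcongr
  have t2 : A₀ * (1 + 3 / 2 * (p * v)) ≤ A := by
    refine le_trans ?_ hAA
    gcongr
    linarith [Real.add_one_le_exp (3 / 2 * (p * v))]
  have e3 : c * (E₀ * Real.exp (-v)) = c₀ * E₀ * Real.exp (u - v) := by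
    rw [hcu, Real.exp_sub, Real.exp_neg]; field_simp
  have t3 : E₀ * (1 - v) ≤ E₀ * Real.exp (-v) := by
    gcongr
    linarith [Real.add_one_le_exp (-v)]
  have e5 : E₀ * Real.exp (-v) / c = E₀ / c₀ * Real.exp (-u - v) := by
    rw [hcu, Real.exp_sub, Real.exp_neg, Real.exp_neg]; field_simp
  have t4 : c₀ * E₀ * (1 + u - v) + 2 * (E₀ / c₀ * (1 - u - v))
      < c₀ * E₀ * Real.exp (u - v) + 2 * (E₀ / c₀ * Real.exp (-u - v)) := by
    have f1 : c₀ * E₀ * (1 + u - v) ≤ c₀ * E₀ * Real.exp (u - v) := by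
      gcongr
      linarith [Real.add_one_le_exp (u - v)]
    have f2 : E₀ / c₀ * (1 - u - v) ≤ E₀ / c₀ * Real.exp (-u - v) := by
      gcongr
      linarith [Real.add_one_le_exp (-u - v)]
    -- The exponents u - v and -u - v vanish together only at the critical point, so elsewhere one
    -- of the two tangent-line bounds is strict.
    by_cases huv : u - v = 0
    · have huv' : -u - v ≠ 0 := by
        intro h
        have hu0 : u = 0 := by linarith
        have hv0 : v = 0 := by linarith
        rw [hu0, Real.exp_zero, mul_one] at hcu
        rw [hv0, Real.exp_zero, mul_one] at hdv
        exact hne (by rw [hcu, hdv])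
      have f3 : E₀ / c₀ * (1 - u - v) < E₀ / c₀ * Real.exp (-u - v) := by
        gcongr
        linarith [Real.add_one_lt_exp huv']
      linarith
    · have f3 : c₀ * E₀ * (1 + u - v) < c₀ * E₀ * Real.exp (u - v) := by
        gcongr
        linarith [Real.add_one_lt_exp huv]
      linarith
  rw [hE, e3, e5]
  -- The coefficients of u and v in the summed tangent-line bounds are the partial derivatives in
  -- log c and log d, zero by criticality.
  have hucoef : c₀ * A₀ + c₀ * E₀ - 2 * (E₀ / c₀) = 0 := by
    rw [h1]; field_simp; ring
  have hvcoef : (c₀ + 1) * A₀ * (3 / 2 * p) - E₀ * (c₀ + 3 + 2 / c₀) = 0 := by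
    have : A₀ * (3 / 2 * p) = E₀ * ((c₀ + 2) / c₀) := by
      rw [← h2, hp]; ring
    rw [mul_assoc, this]; field_simp; ring
  have k1 : u * (c₀ * A₀ + c₀ * E₀ - 2 * (E₀ / c₀)) = 0 := by rw [hucoef, mul_zero]
  have k2 : v * ((c₀ + 1) * A₀ * (3 / 2 * p) - E₀ * (c₀ + 3 + 2 / c₀)) = 0 := by
    rw [hvcoef, mul_zero]
  have k3 : v * (E₀ * (2 / c₀)) = 2 * (v * (E₀ / c₀)) := by ring
  have k4 : E₀ / c₀ * (1 - u - v) = E₀ / c₀ - u * (E₀ / c₀) - v * (E₀ / c₀) := by ring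
  clear_value A A₀ E₀
  clear hcu hdv hgibbs hAA hA hA₀ h1 h2 hE hE₀ hp hu hv hucoef hvcoef e3 e5
  linarith

/-- The equation for the first optimal parameter `b = c + 1`. -/
lemma exists_critical_equation : ∃ c : ℝ, 0.7205 ≤ c ∧ c ≤ 0.72051 ∧
    Real.pi * (3 * c ^ 3 * (c + 2))
      = 6 * (2 - c ^ 2) ^ 2 * √((6 - 3 * c ^ 2) / (6 - c ^ 2 + 4 * c)) := by
  let ψ : ℝ → ℝ := fun c => Real.pi * (3 * c ^ 3 * (c + 2))
      - 6 * (2 - c ^ 2) ^ 2 * √((6 - 3 * c ^ 2) / (6 - c ^ 2 + 4 * c))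
  have hcont : ContinuousOn ψ (Set.Icc 0.7205 0.72051) := by
    have : ContinuousOn (fun c : ℝ => (6 - 3 * c ^ 2) / (6 - c ^ 2 + 4 * c))
        (Set.Icc 0.7205 0.72051) := by
      refine ContinuousOn.div (by fun_prop) (by fun_prop) fun c hc => ?_
      have := hc.1
      have := hc.2
      norm_num at *
      nlinarith
    exact ContinuousOn.sub (by fun_prop) (ContinuousOn.mul (by fun_prop) this.sqrt)
  have hpi := Real.pi_gt_d6
  have hpi' := Real.pi_lt_d6
  have hlo : ψ 0.7205 ≤ 0 := by
    -- The bracket is so short that ψ is tiny at its ends; the square root is needed to about seven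
    -- digits to decide the sign.
    have : (0.7288574 : ℝ) ≤ √((6 - 3 * 0.7205 ^ 2) / (6 - 0.7205 ^ 2 + 4 * 0.7205)) := by
      apply Real.le_sqrt_of_sq_le; norm_num
    simp only [ψ]
    norm_num at *
    nlinarith
  have hhi : 0 ≤ ψ 0.72051 := by
    have : √((6 - 3 * 0.72051 ^ 2) / (6 - 0.72051 ^ 2 + 4 * 0.72051)) ≤ 0.7288528 := by
      rw [Real.sqrt_le_left (by norm_num)]; norm_num
    simp only [ψ]
    norm_num at *
    nlinarith
  obtain ⟨c, hc, h⟩ := intermediate_value_Icc (by norm_num) hcont ⟨hlo, hhi⟩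
  exact ⟨c, hc.1, hc.2, by simp only [ψ] at h; linarith⟩

/-- The optimal parameters together with the value of the objective there. -/
lemma exists_optimal : ∃ c d : ℝ, 0.7205 ≤ c ∧ c ≤ 0.72051 ∧ 0.703 ≤ d ∧ d < 0.704 ∧
    objective (c + 1, d) = 4 * (c + 1) ^ 2 * (6 - c ^ 2 + 4 * c)
      / (3 * Real.pi * c ^ 3 * (c + 2)) ∧
    ∀ q ∈ paramSet, q ≠ (c + 1, d) → objective (c + 1, d) < objective q := by
  obtain ⟨c, hc1, hc2, hc⟩ := exists_critical_equation
  norm_num at hc1 hc2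
  have hN : 0 < 6 - c ^ 2 + 4 * c := by nlinarith
  have hc0 : 0 < c := by linarith
  have hM : 0 < 2 - c ^ 2 := by nlinarith
  have hpi := Real.pi_pos
  -- Dividing the two critical equations eliminates A and E and gives d/(1 - 2d/3) = c(c+2)/(2 -
  -- c²), hence this d.
  obtain ⟨d, hd⟩ : ∃ d, d = 3 * c * (c + 2) / (6 - c ^ 2 + 4 * c) := ⟨_, rfl⟩
  have hd1 : 0.703 ≤ d := by
    rw [hd, le_div_iff₀ hN]; norm_num; nlinarith
  have hd2 : d < 0.704 := by
    rw [hd, div_lt_iff₀ hN]; norm_num; nlinarith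
  norm_num at hd1 hd2
  have hy : 1 - 2 * d / 3 = 3 * (2 - c ^ 2) / (6 - c ^ 2 + 4 * c) := by
    rw [hd, eq_div_iff hN.ne']
    linear_combination (-2 / 3) * div_mul_cancel₀ (3 * c * (c + 2)) hN.ne'
  have hy0 : 0 < 1 - 2 * d / 3 := by rw [hy]; positivity
  have hrpow : (1 - 2 * d / 3) ^ (3 / 2 : ℝ) = (1 - 2 * d / 3) * √(1 - 2 * d / 3) := by
    rw [Real.sqrt_eq_rpow, ← Real.rpow_one_add' hy0.le (by norm_num)]; norm_num
  have hsq : √((6 - 3 * c ^ 2) / (6 - c ^ 2 + 4 * c)) = √(1 - 2 * d / 3) := by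
    rw [hy]; ring_nf
  rw [hsq] at hc
  have hs0 : 0 < √(1 - 2 * d / 3) := Real.sqrt_pos.2 hy0
  have hsv : √(1 - 2 * d / 3) = Real.pi * (3 * c ^ 3 * (c + 2)) / (6 * (2 - c ^ 2) ^ 2) := by
    rw [eq_div_iff (by positivity), hc]; ring
  have h1 : 1 / (1 - 2 * d / 3) ^ (3 / 2 : ℝ) = 2 / (Real.pi * d) * (2 / c ^ 2 - 1) := by
    rw [hrpow, hsv, hy, hd]; field_simp; ring
  have h2 : 1 / (1 - 2 * d / 3) ^ (3 / 2 : ℝ) * (d / (1 - 2 * d / 3))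
      = 2 / (Real.pi * d) * ((c + 2) / c) := by
    rw [h1, hy, hd]; field_simp
  refine ⟨c, d, by norm_num; linarith, by norm_num; linarith, by norm_num; linarith,
    by norm_num; linarith, ?_, fun q hq hne => objective_lt_of_critical hc0 (by linarith)
      (by linarith) h1 h2 hq hne⟩
  rw [objective_eq (by linarith) (by linarith), h1, hd, add_sub_cancel_right]
  field_simp
  ring

lemma C₀_eq_of_optimal {q : ℝ × ℝ} (hq : q ∈ paramSet)
    (hmin : IsMinOn objective paramSet q) : C₀ = 2 / √(2 * Real.pi) * objective q := by
  rw [C₀]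
  congr 1
  refine IsLeast.csInf_eq ⟨⟨q, hq, rfl⟩, ?_⟩
  rintro _ ⟨q', hq', rfl⟩
  exact hmin hq'

lemma sqrt_two_mul_pi_bounds : 2.50662 < √(2 * Real.pi) ∧ √(2 * Real.pi) < 2.50663 := by
  have h1 := Real.pi_gt_d6
  have h2 := Real.pi_lt_d6
  constructor
  · apply Real.lt_sqrt_of_sq_lt; norm_num at *; linarith
  · rw [Real.sqrt_lt' (by norm_num)]; norm_num at *; linarith

lemma exists_unique_minimizer_and_bounds : (∃ q ∈ paramSet,
      IsMinOn objective paramSet q ∧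
      (∀ q' ∈ paramSet, IsMinOn objective paramSet q' → q' = q) ∧
      1.72 ≤ q.1 ∧ q.1 < 1.73 ∧ 0.703 ≤ q.2 ∧ q.2 < 0.704) ∧
    8.23 ≤ C₀ ∧ C₀ < 8.24 := by
  obtain ⟨c, d, hc1, hc2, hd1, hd2, hval, hmin⟩ := exists_optimal
  norm_num at hc1 hc2 hd1 hd2
  have hq : ((c + 1, d) : ℝ × ℝ) ∈ paramSet :=
    ⟨by simp only; linarith, by simp only; linarith, by simp only; linarith⟩
  have hminOn : IsMinOn objective paramSet (c + 1, d) := by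
    intro q hq'
    rcases eq_or_ne q (c + 1, d) with rfl | hne
    · exact le_refl (objective (c + 1, d))
    · exact (hmin q hq' hne).le
  refine ⟨⟨(c + 1, d), hq, hminOn, ?_, ?_, ?_, ?_, ?_⟩, ?_⟩
  · intro q' hq' hmin'
    by_contra hne
    exact (hmin q' hq' hne).not_ge (hmin' hq)
  · norm_num; linarith
  · norm_num; linarith
  · norm_num; linarith
  · norm_num; linarith
  obtain ⟨hs1, hs2⟩ := sqrt_two_mul_pi_bounds
  have hp1 := Real.pi_gt_d6
  have hp2 := Real.pi_lt_d6
  have hpi := Real.pi_pos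
  have hc0 : 0 < c := by linarith
  have hs0 : 0 < √(2 * Real.pi) := by linarith
  have hN : 0 < 6 - c ^ 2 + 4 * c := by nlinarith
  have hNlo : (8.36279 : ℝ) ≤ 6 - c ^ 2 + 4 * c := by norm_num; nlinarith
  have hNhi : 6 - c ^ 2 + 4 * c ≤ (8.36293 : ℝ) := by norm_num; nlinarith
  have hlo : (10.324 : ℝ) ≤ objective (c + 1, d) := by
    rw [hval, le_div_iff₀ (by positivity)]
    calc (10.324 : ℝ) * (3 * Real.pi * c ^ 3 * (c + 2))
        ≤ 10.324 * (3 * 3.141593 * 0.72051 ^ 3 * (0.72051 + 2)) := by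
          gcongr <;> norm_num <;> linarith
      _ ≤ 4 * (0.7205 + 1) ^ 2 * 8.36279 := by norm_num
      _ ≤ _ := by gcongr; linarith
  have hhi : objective (c + 1, d) ≤ (10.3265 : ℝ) := by
    rw [hval, div_le_iff₀ (by positivity)]
    calc 4 * (c + 1) ^ 2 * (6 - c ^ 2 + 4 * c)
        ≤ 4 * (0.72051 + 1) ^ 2 * (8.36293 : ℝ) := by gcongr; linarith
      _ ≤ 10.3265 * (3 * 3.141592 * 0.7205 ^ 3 * (0.7205 + 2)) := by norm_num
      _ ≤ _ := by gcongr <;> norm_num <;> linarith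
  rw [C₀_eq_of_optimal hq hminOn, div_mul_eq_mul_div]
  rw [le_div_iff₀ hs0, div_lt_iff₀ hs0]
  constructor <;> linarith

lemma objective_two_three_quarters :
    2 / √(2 * Real.pi) * objective (2, 3 / 4)
      = 8 / √(2 * Real.pi) * (√2 + 4 / Real.pi) := by
  have hpi := Real.pi_pos
  have h : (1 - 2 * (3 / 4 : ℝ) / 3) ^ (3 / 2 : ℝ) = 1 / (2 * √2) := by
    have : (1 - 2 * (3 / 4 : ℝ) / 3) = 2⁻¹ := by norm_num
    rw [this, Real.inv_rpow (by norm_num), Real.sqrt_eq_rpow, show (3 / 2 : ℝ) = 1 + 1 / 2 by norm_num,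
      Real.rpow_add (by norm_num), Real.rpow_one]
    ring
  simp only [objective]
  rw [h]
  field_simp
  ring

lemma explicit_bounds : 8.57 ≤ 8 / √(2 * Real.pi) * (√2 + 4 / Real.pi) ∧
    8 / √(2 * Real.pi) * (√2 + 4 / Real.pi) < 8.58 := by
  obtain ⟨hs1, hs2⟩ := sqrt_two_mul_pi_bounds
  have hp1 := Real.pi_gt_d6
  have hp2 := Real.pi_lt_d6
  have hpi := Real.pi_pos
  have hs0 : 0 < √(2 * Real.pi) := by linarith
  have h1 : 1.41421 < √2 := by apply Real.lt_sqrt_of_sq_lt; norm_num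
  have h2 : √2 < 1.41422 := by rw [Real.sqrt_lt' (by norm_num)]; norm_num
  have h3 : 1.27323 < 4 / Real.pi := by
    rw [lt_div_iff₀ hpi]; linarith
  have h4 : 4 / Real.pi < 1.27324 := by
    rw [div_lt_iff₀ hpi]; linarith
  rw [div_mul_eq_mul_div, le_div_iff₀ hs0, div_lt_iff₀ hs0]
  constructor <;> linarith

/-! ### Taylor estimates and characteristic functions of sums -/

open Complex in
/-- Third-order Taylor bound for `exp (i x)`. -/
lemma norm_exp_mul_I_sub_quadratic_le (x : ℝ) :
    ‖cexp (x * I) - (1 + x * I - x ^ 2 / 2)‖ ≤ |x| ^ 3 / 6 := by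
  have key : ∀ x : ℝ, 0 ≤ x → ‖cexp (x * I) - (1 + x * I - x ^ 2 / 2)‖ ≤ x ^ 3 / 6 := by
    intro x hx
    have hexp : ∀ t : ℝ, HasDerivAt (fun t : ℝ => cexp (t * I)) (cexp (t * I) * I) t := fun t => by
      have h : HasDerivAt (fun t : ℝ => (t : ℂ) * I) I t := by
        simpa using (ofRealCLM.hasDerivAt (x := t)).mul_const I
      exact h.cexp
    have hlin : ∀ t : ℝ, HasDerivAt (fun t : ℝ => (1 : ℂ) + t * I) I t := fun t => by
      simpa using ((ofRealCLM.hasDerivAt (x := t)).mul_const I).const_add 1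
    have hquad : ∀ t : ℝ, HasDerivAt (fun t : ℝ => (t : ℂ) ^ 2 / 2) (t : ℂ) t := fun t => by
      have := ((ofRealCLM.hasDerivAt (x := t)).fun_pow 2).div_const 2
      exact this.congr_deriv (by simp)
    -- Each Taylor remainder has derivative I times the preceding one, so integrating |exp(is) - 1|
    -- ≤ s twice gives the cubic bound.
    have h2 : ∀ t : ℝ, 0 ≤ t → ‖cexp (t * I) - (1 + t * I)‖ ≤ t ^ 2 / 2 := by
      intro t ht
      have hd : ∀ s : ℝ, HasDerivAt (fun s : ℝ => cexp (s * I) - (1 + s * I))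
          (cexp (s * I) * I - I) s := fun s => (hexp s).sub (hlin s)
      refine image_norm_le_of_norm_deriv_right_le_deriv_boundary
        (f := fun s : ℝ => cexp (s * I) - (1 + s * I)) (B := fun s => s ^ 2 / 2) (B' := fun s => s)
        (a := 0) (b := t) (fun s _ => (hd s).continuousAt.continuousWithinAt)
        (fun s _ => (hd s).hasDerivWithinAt) (by simp) (fun s => ?_) (fun s hs => ?_)
        (Set.right_mem_Icc.2 ht)
      · simpa using ((hasDerivAt_id s).fun_pow 2).div_const 2
      · have : cexp (s * I) * I - I = (cexp (I * s) - 1) * I := by rw [mul_comm I]; ring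
        rw [this, norm_mul, norm_I, mul_one]
        simpa [abs_of_nonneg hs.1] using Real.norm_exp_I_mul_ofReal_sub_one_le (x := s)
    have hd : ∀ s : ℝ, HasDerivAt (fun s : ℝ => cexp (s * I) - (1 + s * I - s ^ 2 / 2))
        (cexp (s * I) * I - (I - s)) s := fun s => (hexp s).sub ((hlin s).sub (hquad s))
    refine image_norm_le_of_norm_deriv_right_le_deriv_boundary
      (f := fun s : ℝ => cexp (s * I) - (1 + s * I - s ^ 2 / 2)) (B := fun s => s ^ 3 / 6)
      (B' := fun s => s ^ 2 / 2)
      (a := 0) (b := x) (fun s _ => (hd s).continuousAt.continuousWithinAt)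
      (fun s _ => (hd s).hasDerivWithinAt) (by simp) (fun s => ?_) (fun s hs => ?_)
      (Set.right_mem_Icc.2 hx)
    · exact (((hasDerivAt_id s).fun_pow 3).div_const 6).congr_deriv (by simp; ring)
    · have : cexp (s * I) * I - (I - s) = (cexp (s * I) - (1 + s * I)) * I := by
        linear_combination (s : ℂ) * I_mul_I
      rw [this, norm_mul, norm_I, mul_one]
      exact h2 s hs.1
  rcases le_total 0 x with hx | hx
  · rw [abs_of_nonneg hx]; exact key x hx
  · rw [abs_of_nonpos hx]
    have := key (-x) (by linarith)
    rw [← norm_conj] at this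
    convert this using 2
    simp [← exp_conj, map_ofNat]

lemma abs_exp_neg_sq_half_sub_le {s : ℝ} (hs : 0 ≤ s) :
    |Real.exp (-(s ^ 2 / 2)) - (1 - s ^ 2 / 2)| ≤ s ^ 3 / 4 := by
  have h1 := Real.one_sub_le_exp_neg (s ^ 2 / 2)
  rw [abs_of_nonneg (by linarith)]
  -- The next Taylor term s⁴/8 is at most s³/4 exactly when s ≤ 2; beyond that, s²/2 ≤ s³/4
  -- suffices.
  rcases le_total s 2 with h | h
  · have h2 : Real.exp (-(s ^ 2 / 2)) ≤ 1 - s ^ 2 / 2 + (s ^ 2 / 2) ^ 2 / 2 := by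
      have hu : 0 ≤ s ^ 2 / 2 := by positivity
      generalize s ^ 2 / 2 = u at hu
      rw [Real.exp_neg, inv_le_iff_one_le_mul₀ (Real.exp_pos _)]
      have := Real.quadratic_le_exp_of_nonneg hu
      have hpos : 0 ≤ 1 - u + u ^ 2 / 2 := by nlinarith [sq_nonneg (u - 1)]
      calc (1 : ℝ) ≤ (1 - u + u ^ 2 / 2) * (1 + u + u ^ 2 / 2) := by
            nlinarith [sq_nonneg (u ^ 2)]
        _ ≤ _ := by gcongr
    nlinarith [pow_nonneg hs 3]
  · have h2 : Real.exp (-(s ^ 2 / 2)) ≤ 1 := by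
      rw [Real.exp_le_one_iff]; nlinarith
    nlinarith [sq_nonneg s]

/-- Comparison of a value `f` of a characteristic function with the Gaussian value `exp (-s²/2)`
of the same variance, both damped by the factor `exp (-(s²/2 - 3k/8))`. -/
lemma damped_bounds {s k : ℝ} {f : ℂ} (hs : 0 ≤ s) (hk : s ^ 3 ≤ k)
    (hf : ‖f - ((1 - s ^ 2 / 2 : ℝ) : ℂ)‖ ≤ k / 6) (hf1 : ‖f‖ ≤ 1) :
    ‖f‖ ≤ Real.exp (-(s ^ 2 / 2 - 3 / 8 * k)) ∧
    Real.exp (-(s ^ 2 / 2)) ≤ Real.exp (-(s ^ 2 / 2 - 3 / 8 * k)) ∧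
    ‖f - (Real.exp (-(s ^ 2 / 2)) : ℂ)‖ ≤ k / 2 * Real.exp (-(s ^ 2 / 2 - 3 / 8 * k)) := by
  have hk0 : 0 ≤ k := le_trans (by positivity) hk
  refine ⟨?_, ?_, ?_⟩
  -- The constant 3/8 makes the damping factor at least 1 once s ≥ 4/3, hence for s² ≥ 2, where 1 -
  -- s²/2 is no longer nonnegative.
  · rcases le_total (s ^ 2) 2 with h | h
    · calc ‖f‖ = ‖(f - ((1 - s ^ 2 / 2 : ℝ) : ℂ)) + ((1 - s ^ 2 / 2 : ℝ) : ℂ)‖ := by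
            rw [sub_add_cancel]
        _ ≤ k / 6 + (1 - s ^ 2 / 2) := by
            refine (norm_add_le _ _).trans (add_le_add hf ?_)
            rw [Complex.norm_real, Real.norm_eq_abs, abs_of_nonneg (by linarith)]
        _ ≤ 1 - (s ^ 2 / 2 - 3 / 8 * k) := by linarith
        _ ≤ _ := Real.one_sub_le_exp_neg _
    · refine hf1.trans (Real.one_le_exp ?_)
      have : 4 / 3 ≤ s := by nlinarith
      nlinarith [mul_le_mul_of_nonneg_right this (sq_nonneg s)]
  · apply Real.exp_le_exp.2; linarith
  · have h1 : ‖f - (Real.exp (-(s ^ 2 / 2)) : ℂ)‖ ≤ 5 / 12 * k := by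
      calc _ = ‖(f - ((1 - s ^ 2 / 2 : ℝ) : ℂ))
              - ((Real.exp (-(s ^ 2 / 2)) - (1 - s ^ 2 / 2) : ℝ) : ℂ)‖ := by
            congr 1; push_cast; ring
        _ ≤ k / 6 + s ^ 3 / 4 := by
            refine (norm_sub_le _ _).trans (add_le_add hf ?_)
            rw [Complex.norm_real]
            exact abs_exp_neg_sq_half_sub_le hs
        _ ≤ _ := by linarith
    have h2 : 5 / 6 ≤ Real.exp (-(s ^ 2 / 2 - 3 / 8 * k)) := by
      refine le_trans ?_ (Real.one_sub_le_exp_neg _)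
      -- Here s = 8/9 minimises 1 - s²/2 + 3s³/8 over s ≥ 0. The minimum exceeds 5/6, the factor
      -- that turns 5k/12 into k/2 times the damping.
      have : 0 ≤ (s - 8 / 9) ^ 2 * (s + 4 / 9) := by positivity
      nlinarith
    nlinarith

/-- Telescoping with a common majorant m i for both factors. Measuring each error relative to m i
keeps the full product of majorants, so no Gaussian damping factor is lost. -/
lemma norm_prod_sub_prod_le {ι : Type*} (S : Finset ι) (f g : ι → ℂ) (m η : ι → ℝ)
    (hf : ∀ i ∈ S, ‖f i‖ ≤ m i) (hg : ∀ i ∈ S, ‖g i‖ ≤ m i)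
    (hfg : ∀ i ∈ S, ‖f i - g i‖ ≤ η i * m i) :
    ‖∏ i ∈ S, f i - ∏ i ∈ S, g i‖ ≤ (∑ i ∈ S, η i) * ∏ i ∈ S, m i := by
  classical
  induction S using Finset.induction_on with
  | empty => simp
  | insert i S hi ih =>
    simp only [Finset.forall_mem_insert] at hf hg hfg
    rw [Finset.prod_insert hi, Finset.prod_insert hi, Finset.prod_insert hi, Finset.sum_insert hi]
    have ih := ih hf.2 hg.2 hfg.2
    have hm : 0 ≤ m i := (norm_nonneg _).trans hf.1
    have hP : ‖∏ j ∈ S, f j‖ ≤ ∏ j ∈ S, m j := by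
      rw [norm_prod]; exact Finset.prod_le_prod (fun _ _ => norm_nonneg _) hf.2
    calc ‖f i * ∏ j ∈ S, f j - g i * ∏ j ∈ S, g j‖
        = ‖(f i - g i) * ∏ j ∈ S, f j + g i * (∏ j ∈ S, f j - ∏ j ∈ S, g j)‖ := by
          congr 1; ring
      _ ≤ ‖f i - g i‖ * ‖∏ j ∈ S, f j‖ + ‖g i‖ * ‖∏ j ∈ S, f j - ∏ j ∈ S, g j‖ := by
          refine (norm_add_le _ _).trans_eq ?_
          rw [norm_mul, norm_mul]
      _ ≤ (η i * m i) * ∏ j ∈ S, m j + m i * ((∑ j ∈ S, η j) * ∏ j ∈ S, m j) := by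
          gcongr
          · exact (norm_nonneg _).trans hfg.1
          · exact hfg.1
          · exact hg.1
      _ = _ := by ring

section OneVariable

variable {Ω : Type*} [MeasurableSpace Ω] {P : Measure Ω} [IsProbabilityMeasure P] {X : Ω → ℝ}

lemma integrable_of_integrable_abs_cube (hX : Measurable X)
    (h3 : Integrable (fun ω => |X ω| ^ 3) P) : Integrable X P := by
  refine Integrable.mono' (h3.add (integrable_const 1)) hX.aestronglyMeasurable (.of_forall fun ω => ?_)
  simp only [Pi.add_apply, Real.norm_eq_abs]
  nlinarith [abs_nonneg (X ω), sq_nonneg (|X ω| - 1), mul_nonneg (abs_nonneg (X ω)) (sq_nonneg (|X ω| - 1))]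

lemma integrable_sq_of_integrable_abs_cube (hX : Measurable X)
    (h3 : Integrable (fun ω => |X ω| ^ 3) P) : Integrable (fun ω => X ω ^ 2) P := by
  refine Integrable.mono' (h3.add (integrable_const 1)) (by fun_prop) (.of_forall fun ω => ?_)
  simp only [Pi.add_apply, Real.norm_eq_abs, abs_pow]
  nlinarith [abs_nonneg (X ω), sq_nonneg (|X ω| - 1), mul_nonneg (abs_nonneg (X ω)) (sq_nonneg (|X ω| - 1))]

/-- Lyapunov's inequality between the second and third absolute moments. -/
lemma sqrt_integral_sq_cube_le (hX : Measurable X) (h3 : Integrable (fun ω => |X ω| ^ 3) P) :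
    √(∫ ω, X ω ^ 2 ∂P) ^ 3 ≤ ∫ ω, |X ω| ^ 3 ∂P := by
  have h2 := integrable_sq_of_integrable_abs_cube hX h3
  have hv : 0 ≤ ∫ ω, X ω ^ 2 ∂P := integral_nonneg fun ω => sq_nonneg _
  set s := √(∫ ω, X ω ^ 2 ∂P) with hs
  have hs2 : s ^ 2 = ∫ ω, X ω ^ 2 ∂P := Real.sq_sqrt hv
  have hs0 : 0 ≤ s := Real.sqrt_nonneg _
  -- Integrates 3s x² ≤ 2|x|³ + s³, an equality at |x| = s; with s the L² norm it reads 3s³ ≤ 2E|X|³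
  -- + s³.
  have : ∫ ω, 3 * s * X ω ^ 2 ∂P ≤ ∫ ω, (2 * |X ω| ^ 3 + s ^ 3) ∂P := by
    refine integral_mono (h2.const_mul _) ((h3.const_mul _).add (integrable_const _)) fun ω => ?_
    simp only
    rw [← sq_abs (X ω)]
    nlinarith [mul_nonneg (sq_nonneg (|X ω| - s)) (by positivity : 0 ≤ 2 * |X ω| + s)]
  rw [integral_const_mul, integral_add (h3.const_mul _) (integrable_const _), integral_const_mul,
    ← hs2] at this
  simp only [integral_const, probReal_univ, smul_eq_mul, one_mul] at this
  nlinarith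

lemma norm_charFun_sub_quadratic_le (hX : Measurable X)
    (h3 : Integrable (fun ω => |X ω| ^ 3) P) (h0 : ∫ ω, X ω ∂P = 0) (τ : ℝ) :
    ‖charFun (P.map X) τ - ((1 - τ ^ 2 * (∫ ω, X ω ^ 2 ∂P) / 2 : ℝ) : ℂ)‖
      ≤ |τ| ^ 3 * (∫ ω, |X ω| ^ 3 ∂P) / 6 := by
  have h1 := integrable_of_integrable_abs_cube hX h3
  have h2 := integrable_sq_of_integrable_abs_cube hX h3
  have hexp : Integrable (fun ω => Complex.exp ((τ * X ω : ℝ) * Complex.I)) P := by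
    refine Integrable.mono' (integrable_const (1 : ℝ)) (by fun_prop) (.of_forall fun ω => ?_)
    rw [Complex.norm_exp_ofReal_mul_I]
  have hc : charFun (P.map X) τ = ∫ ω, Complex.exp ((τ * X ω : ℝ) * Complex.I) ∂P := by
    rw [charFun_apply_real, integral_map hX.aemeasurable (by fun_prop)]
    simp
  have hq : Integrable (fun ω => (1 : ℂ) + ((τ * X ω : ℝ) : ℂ) * Complex.I
      - ((τ * X ω : ℝ) : ℂ) ^ 2 / 2) P := by
    have a1 : Integrable (fun ω => ((τ * X ω : ℝ) : ℂ)) P := (h1.const_mul τ).ofReal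
    have a2 : Integrable (fun ω => ((τ * X ω : ℝ) : ℂ) ^ 2) P := by
      have := (h2.const_mul (τ ^ 2)).ofReal (𝕜 := ℂ)
      refine this.congr (.of_forall fun ω => ?_)
      simp; ring
    exact ((integrable_const _).add (a1.mul_const _)).sub (a2.div_const 2)
  have hm : ((1 - τ ^ 2 * (∫ ω, X ω ^ 2 ∂P) / 2 : ℝ) : ℂ)
      = ∫ ω, ((1 : ℂ) + ((τ * X ω : ℝ) : ℂ) * Complex.I - ((τ * X ω : ℝ) : ℂ) ^ 2 / 2) ∂P := by
    have a1 : Integrable (fun ω => ((τ * X ω : ℝ) : ℂ) * Complex.I) P :=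
      (h1.const_mul τ).ofReal.mul_const _
    have a2 : Integrable (fun ω => ((τ * X ω : ℝ) : ℂ) ^ 2 / 2) P := by
      have := (h2.const_mul (τ ^ 2 / 2)).ofReal (𝕜 := ℂ)
      refine this.congr (.of_forall fun ω => ?_)
      simp; ring
    have a3 : Integrable (fun ω => 1 + ((τ * X ω : ℝ) : ℂ) * Complex.I) P :=
      (integrable_const _).add a1
    rw [integral_sub a3 a2, integral_add (integrable_const _) a1,
      integral_mul_const, integral_complex_ofReal, integral_const_mul, h0]
    have : ∫ ω, ((τ * X ω : ℝ) : ℂ) ^ 2 / 2 ∂P = ((τ ^ 2 * (∫ ω, X ω ^ 2 ∂P) / 2 : ℝ) : ℂ) := by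
      rw [mul_div_right_comm, ← integral_const_mul, ← integral_complex_ofReal]
      congr 1; ext ω; push_cast; ring
    rw [this]
    simp
  rw [hc, hm, ← integral_sub hexp hq]
  calc _ ≤ ∫ ω, |τ| ^ 3 / 6 * |X ω| ^ 3 ∂P := by
        refine norm_integral_le_of_norm_le (h3.const_mul _) (.of_forall fun ω => ?_)
        refine (norm_exp_mul_I_sub_quadratic_le _).trans_eq ?_
        rw [abs_mul]; ring
    _ = _ := by rw [integral_const_mul]; ring

end OneVariable

/-- The characteristic function of a sum of independent centred variables is close to that of the
Gaussian law with the same variance. -/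
lemma norm_charFun_sum_sub_gaussian_le {Ω : Type*} [MeasurableSpace Ω] {P : Measure Ω}
    [IsProbabilityMeasure P] {n : ℕ} {X : Fin n → Ω → ℝ} (hX : ∀ k, Measurable (X k))
    (hind : iIndepFun X P) (h3 : ∀ k, Integrable (fun ω => |X k ω| ^ 3) P)
    (h0 : ∀ k, ∫ ω, X k ω ∂P = 0) (τ : ℝ) :
    ‖charFun (P.map (partialSum X)) τ - (Real.exp (-(τ ^ 2 * varSum P X / 2)) : ℂ)‖
      ≤ |τ| ^ 3 * (∑ k, ∫ ω, |X k ω| ^ 3 ∂P) / 2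
        * Real.exp (-(τ ^ 2 * varSum P X / 2 - 3 / 8 * (|τ| ^ 3 * ∑ k, ∫ ω, |X k ω| ^ 3 ∂P))) := by
  have hs : P.map (partialSum X) = P.map (fun ω => ∑ k, X k ω) := rfl
  rw [hs, iIndepFun.charFun_map_fun_sum_eq_prod (fun k => (hX k).aemeasurable) hind,
    Finset.prod_apply]
  have key : ∀ k, _ := fun k => by
    have hv : 0 ≤ ∫ ω, X k ω ^ 2 ∂P := integral_nonneg fun ω => sq_nonneg _
    have : IsProbabilityMeasure (P.map (X k)) :=
      Measure.isProbabilityMeasure_map (hX k).aemeasurable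
    have hsq : (|τ| * √(∫ ω, X k ω ^ 2 ∂P)) ^ 2 = τ ^ 2 * ∫ ω, X k ω ^ 2 ∂P := by
      rw [mul_pow, sq_abs, Real.sq_sqrt hv]
    have := damped_bounds (s := |τ| * √(∫ ω, X k ω ^ 2 ∂P))
      (k := |τ| ^ 3 * ∫ ω, |X k ω| ^ 3 ∂P) (f := charFun (P.map (X k)) τ) (by positivity)
      (by rw [mul_pow]; gcongr; exact sqrt_integral_sq_cube_le (hX k) (h3 k))
      (by rw [hsq]; exact norm_charFun_sub_quadratic_le (hX k) (h3 k) (h0 k) τ)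
      (norm_charFun_le_one _)
    rw [hsq] at this
    exact this
  have := norm_prod_sub_prod_le Finset.univ (fun k => charFun (P.map (X k)) τ)
    (fun k => (Real.exp (-(τ ^ 2 * (∫ ω, X k ω ^ 2 ∂P) / 2)) : ℂ)) _ _ (fun k _ => (key k).1)
    (fun k _ => by
      rw [Complex.norm_real, Real.norm_eq_abs, Real.abs_exp]
      exact (key k).2.1) (fun k _ => (key k).2.2)
  have e1 : ∏ k, (Real.exp (-(τ ^ 2 * (∫ ω, X k ω ^ 2 ∂P) / 2)) : ℂ)
      = (Real.exp (-(τ ^ 2 * varSum P X / 2)) : ℂ) := by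
    rw [← Complex.ofReal_prod, ← Real.exp_sum]
    simp only [varSum, Finset.mul_sum, Finset.sum_div, Finset.sum_neg_distrib]
  rw [e1] at this
  refine this.trans_eq ?_
  rw [← Real.exp_sum]
  simp only [varSum, Finset.mul_sum, Finset.sum_div, Finset.sum_neg_distrib, Finset.sum_sub_distrib]

/-! ### The Fejér kernel and its Fourier transform -/

/-- The triangle function supported on `[-1, 1]`, the Fourier transform of the Fejér kernel. -/
noncomputable def triangle (t : ℝ) : ℝ := max 0 (1 - |t|)

/-- The Fejér kernel, a continuous version of `(1 - cos y) / (π y²)`. -/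
noncomputable def fejer (y : ℝ) : ℝ := 1 / Real.pi * ∫ t in (0 : ℝ)..1, (1 - t) * Real.cos (t * y)

lemma continuous_triangle : Continuous triangle := by unfold triangle; fun_prop

lemma triangle_nonneg (t : ℝ) : 0 ≤ triangle t := le_max_left _ _

lemma triangle_le_one (t : ℝ) : triangle t ≤ 1 :=
  max_le zero_le_one (by linarith [abs_nonneg t])

lemma triangle_neg (t : ℝ) : triangle (-t) = triangle t := by simp [triangle]

lemma triangle_of_mem {t : ℝ} (h0 : 0 ≤ t) (h1 : t ≤ 1) : triangle t = 1 - t := by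
  rw [triangle, abs_of_nonneg h0, max_eq_right (by linarith)]

lemma support_triangle_subset : Function.support triangle ⊆ Set.Ioc (-1) 1 := by
  intro t ht
  by_contra h
  apply ht
  rw [Set.mem_Ioc, not_and_or] at h
  apply max_eq_left
  rcases h with h | h
  · linarith [neg_abs_le t]
  · linarith [le_abs_self t]

lemma continuous_fejer : Continuous fejer := by
  unfold fejer
  refine continuous_const.mul
    (intervalIntegral.continuous_parametric_intervalIntegral_of_continuous' ?_ 0 1)
  fun_prop

lemma fejer_neg (y : ℝ) : fejer (-y) = fejer y := by simp [fejer]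

lemma fejer_of_ne_zero {y : ℝ} (hy : y ≠ 0) :
    fejer y = (1 - Real.cos y) / (Real.pi * y ^ 2) := by
  have h : ∫ t in (0 : ℝ)..1, (1 - t) * Real.cos (t * y)
      = ((1 - 1) * Real.sin (1 * y) / y - Real.cos (1 * y) / y ^ 2)
        - ((1 - 0) * Real.sin (0 * y) / y - Real.cos (0 * y) / y ^ 2) := by
    refine intervalIntegral.integral_eq_sub_of_hasDerivAt
      (f := fun t => (1 - t) * Real.sin (t * y) / y - Real.cos (t * y) / y ^ 2) (fun t _ => ?_)
      (Continuous.intervalIntegrable (by fun_prop) _ _)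
    have hl : HasDerivAt (fun t : ℝ => t * y) y t := by simpa using (hasDerivAt_id t).mul_const y
    have h1 : HasDerivAt (fun t : ℝ => 1 - t) (-1) t := by
      simpa using (hasDerivAt_id t).const_sub 1
    refine (((h1.mul hl.sin).div_const y).sub (hl.cos.div_const (y ^ 2))).congr_deriv ?_
    field_simp
    ring
  rw [fejer, h]
  simp
  field_simp
  ring

lemma fejer_nonneg (y : ℝ) : 0 ≤ fejer y := by
  have hpi := Real.pi_pos
  rcases eq_or_ne y 0 with rfl | hy
  · refine mul_nonneg (by positivity) (intervalIntegral.integral_nonneg zero_le_one fun t ht => ?_)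
    simp only [mul_zero, Real.cos_zero, mul_one]
    linarith [ht.2]
  · rw [fejer_of_ne_zero hy]
    exact div_nonneg (by linarith [Real.cos_le_one y]) (by positivity)

lemma fejer_le_inv_sq (y : ℝ) : fejer y ≤ 2 / Real.pi * (y ^ 2)⁻¹ ∨ y = 0 := by
  have hpi := Real.pi_pos
  rcases eq_or_ne y 0 with rfl | hy
  · exact Or.inr rfl
  · left
    rw [fejer_of_ne_zero hy, div_mul_eq_div_div_swap, div_eq_mul_inv _ Real.pi,
      div_eq_mul_inv _ (y ^ 2), div_eq_mul_inv 2]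
    have : 1 - Real.cos y ≤ 2 := by linarith [Real.neg_one_le_cos y]
    calc (1 - Real.cos y) * (y ^ 2)⁻¹ * Real.pi⁻¹ ≤ 2 * (y ^ 2)⁻¹ * Real.pi⁻¹ := by gcongr
      _ = _ := by ring

lemma fejer_le_one (y : ℝ) : fejer y ≤ 1 := by
  have hpi := Real.pi_gt_three
  have h : ∫ t in (0 : ℝ)..1, (1 - t) * Real.cos (t * y) ≤ ∫ t in (0 : ℝ)..1, (1 : ℝ) := by
    refine intervalIntegral.integral_mono_on zero_le_one
      (Continuous.intervalIntegrable (by fun_prop) _ _)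
      (Continuous.intervalIntegrable (by fun_prop) _ _) fun t ht => ?_
    have := Real.cos_le_one (t * y)
    nlinarith [ht.1, ht.2, Real.neg_one_le_cos (t * y)]
  simp only [intervalIntegral.integral_const, sub_zero, smul_eq_mul, mul_one] at h
  rw [fejer, one_div_mul_eq_div, div_le_one (by linarith)]
  linarith

lemma fejer_le_inv_one_add_sq (y : ℝ) : fejer y ≤ 2 * (1 + y ^ 2)⁻¹ := by
  have hpi := Real.pi_gt_three
  rw [← div_eq_mul_inv, le_div_iff₀ (by positivity)]
  rcases le_total (y ^ 2) 1 with h | h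
  · nlinarith [fejer_le_one y, fejer_nonneg y]
  · have hy : y ≠ 0 := by rintro rfl; norm_num at h
    have := (fejer_le_inv_sq y).resolve_right hy
    calc fejer y * (1 + y ^ 2) ≤ 2 / Real.pi * (y ^ 2)⁻¹ * (2 * y ^ 2) := by
          gcongr; linarith
      _ = 4 / Real.pi := by field_simp; norm_num
      _ ≤ 2 := by rw [div_le_iff₀ (by linarith)]; linarith

lemma integrable_fejer : Integrable fejer := by
  refine Integrable.mono' (integrable_inv_one_add_sq.const_mul 2)
    continuous_fejer.aestronglyMeasurable (.of_forall fun y => ?_)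
  rw [Real.norm_eq_abs, abs_of_nonneg (fejer_nonneg y)]
  exact fejer_le_inv_one_add_sq y

open Complex in
lemma integral_triangle_mul_cexp (y : ℝ) :
    ∫ t in (-1 : ℝ)..1, (triangle t : ℂ) * cexp (-(t * y : ℝ) * I) = 2 * Real.pi * fejer y := by
  have hcont : Continuous fun t : ℝ => (triangle t : ℂ) * cexp (-(t * y : ℝ) * I) := by
    have := continuous_triangle
    fun_prop
  have hi := fun a b => hcont.intervalIntegrable (μ := volume) a b
  have hcont' : Continuous fun t : ℝ => (triangle t : ℂ) * cexp (-((-t : ℝ) * y : ℝ) * I) := by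
    have := continuous_triangle
    fun_prop
  have hi' := fun a b => hcont'.intervalIntegrable (μ := volume) a b
  rw [← intervalIntegral.integral_add_adjacent_intervals (hi (-1) 0) (hi 0 1)]
  have h1 : ∫ t in (-1 : ℝ)..0, (triangle t : ℂ) * cexp (-(t * y : ℝ) * I)
      = ∫ t in (0 : ℝ)..1, (triangle t : ℂ) * cexp (-((-t : ℝ) * y : ℝ) * I) := by
    have := intervalIntegral.integral_comp_neg (a := 0) (b := 1)
      (fun t : ℝ => (triangle t : ℂ) * cexp (-(t * y : ℝ) * I))
    simp only [neg_zero, triangle_neg] at this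
    exact this.symm
  rw [h1, ← intervalIntegral.integral_add (hi' 0 1) (hi 0 1)]
  have h2 : ∫ t in (0 : ℝ)..1, ((triangle t : ℂ) * cexp (-((-t : ℝ) * y : ℝ) * I)
      + (triangle t : ℂ) * cexp (-(t * y : ℝ) * I))
      = ∫ t in (0 : ℝ)..1, ((2 * ((1 - t) * Real.cos (t * y)) : ℝ) : ℂ) := by
    refine intervalIntegral.integral_congr fun t ht => ?_
    rw [Set.uIcc_of_le zero_le_one] at ht
    rw [triangle_of_mem ht.1 ht.2, ← mul_add]
    push_cast
    rw [Complex.cos]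
    ring_nf
  rw [h2, intervalIntegral.integral_ofReal, intervalIntegral.integral_const_mul, fejer]
  generalize ∫ t in (0 : ℝ)..1, (1 - t) * Real.cos (t * y) = J
  have : (Real.pi : ℂ) ≠ 0 := by exact_mod_cast Real.pi_ne_zero
  push_cast
  field_simp

open FourierTransform in
lemma fourier_triangle (w : ℝ) :
    𝓕 (fun t => (triangle t : ℂ)) w = 2 * Real.pi * fejer (2 * Real.pi * w) := by
  rw [Real.fourier_real_eq_integral_exp_smul, ← integral_triangle_mul_cexp,
    intervalIntegral.integral_eq_integral_of_support_subset]
  · congr 1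
    ext t
    rw [smul_eq_mul, mul_comm]
    congr 3
    push_cast
    ring
  · refine subset_trans (fun t ht => ?_) support_triangle_subset
    intro h
    apply ht
    simp [h]

-- Fourier inversion for the triangle function at 0, where the triangle equals 1.
open FourierTransform in
lemma integral_fejer : ∫ y, fejer y = 1 := by
  have hpi := Real.pi_pos
  have hc : Continuous fun t => (triangle t : ℂ) := Complex.continuous_ofReal.comp continuous_triangle
  have hint : Integrable (fun t => (triangle t : ℂ)) :=
    hc.integrable_of_hasCompactSupport (HasCompactSupport.intro (isCompact_Icc (a := (-1 : ℝ)) (b := 1))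
      fun t ht => by
        by_contra h
        refine ht (Set.Ioc_subset_Icc_self (support_triangle_subset fun h0 => h ?_))
        rw [h0, Complex.ofReal_zero])
  have hF : 𝓕 (fun t => (triangle t : ℂ))
      = fun w => ((2 * Real.pi * fejer (2 * Real.pi * w) : ℝ) : ℂ) := by
    ext w
    rw [fourier_triangle]
    push_cast
    rfl
  have hFint : Integrable (𝓕 (fun t => (triangle t : ℂ))) := by
    rw [hF]
    exact ((integrable_fejer.comp_mul_left' (by positivity)).const_mul _).ofReal
  have h := hint.fourierInv_fourier_eq hFint (v := 0) hc.continuousAt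
  rw [Real.fourierInv_eq, hF] at h
  simp only [inner_zero_right, AddChar.map_zero_eq_one, one_smul] at h
  rw [integral_complex_ofReal, integral_const_mul, Measure.integral_comp_mul_left,
    abs_of_pos (by positivity)] at h
  have h' := Complex.ofReal_injective h
  rw [smul_eq_mul, triangle_of_mem le_rfl zero_le_one, sub_zero] at h'
  rw [← h']
  field_simp

/-- Each tail contributes at most the integral of 2/(πy²) over (h, ∞). -/
lemma one_sub_integral_fejer_Icc_le {h : ℝ} (hh : 0 < h) :
    1 - ∫ y in Set.Icc (-h) h, fejer y ≤ 4 / (Real.pi * h) := by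
  have hpi := Real.pi_pos
  have h1 : (∫ y in Set.Icc (-h) h, fejer y) + ∫ y in (Set.Icc (-h) h)ᶜ, fejer y = 1 := by
    rw [integral_add_compl measurableSet_Icc integrable_fejer, integral_fejer]
  have hset : (Set.Icc (-h) h)ᶜ = Set.Iio (-h) ∪ Set.Ioi h := by
    ext y
    simp only [Set.mem_compl_iff, Set.mem_Icc, Set.mem_union, Set.mem_Iio, Set.mem_Ioi]
    rw [not_and_or, not_le, not_le]
  have hIoi : ∫ y in Set.Ioi h, fejer y ≤ 2 / (Real.pi * h) := by
    have hint : IntegrableOn (fun y : ℝ => 2 / Real.pi * y ^ (-2 : ℝ)) (Set.Ioi h) :=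
      (integrableOn_Ioi_rpow_of_lt (by norm_num) hh).const_mul _
    calc _ ≤ ∫ y in Set.Ioi h, 2 / Real.pi * y ^ (-2 : ℝ) := by
          refine setIntegral_mono_on integrable_fejer.integrableOn hint measurableSet_Ioi
            fun y hy => ?_
          have hy0 : 0 < y := hh.trans hy
          have := (fejer_le_inv_sq y).resolve_right hy0.ne'
          rwa [Real.rpow_neg hy0.le, Real.rpow_two]
      _ = _ := by
          rw [integral_const_mul, integral_Ioi_rpow_of_lt (by norm_num) hh]
          have : (-2 + 1 : ℝ) = -1 := by norm_num
          rw [this, Real.rpow_neg_one]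
          field_simp
  have hIio : ∫ y in Set.Iio (-h), fejer y = ∫ y in Set.Ioi h, fejer y := by
    rw [← integral_Iic_eq_integral_Iio, ← integral_comp_neg_Ioi]
    simp only [fejer_neg]
  rw [hset, setIntegral_union (Set.disjoint_left.2 fun y hy hy' => by
      simp only [Set.mem_Iio, Set.mem_Ioi] at hy hy'; linarith) measurableSet_Ioi
    integrable_fejer.integrableOn integrable_fejer.integrableOn, hIio] at h1
  have : 4 / (Real.pi * h) = 2 / (Real.pi * h) + 2 / (Real.pi * h) := by ring
  linarith

/-- By oddness, the linear part of an affine lower bound costs nothing when averaged. -/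
lemma integral_id_mul_fejer_Icc (h : ℝ) (hh : 0 ≤ h) :
    ∫ y in Set.Icc (-h) h, y * fejer y = 0 := by
  rw [integral_Icc_eq_integral_Ioc, ← intervalIntegral.integral_of_le (by linarith)]
  have := intervalIntegral.integral_comp_neg (a := -h) (b := h) (fun y => y * fejer y)
  simp only [fejer_neg, neg_neg, neg_mul, intervalIntegral.integral_neg] at this
  linarith

/-! ### Fourier representation of smoothed interval probabilities -/

/-- Fubini. Bounded intervals replace half-lines so that the Fourier integral of the indicator
converges and has no singularity at frequency 0. -/
lemma integral_fejer_mul_measureReal_Ico (μ : Measure ℝ) [IsProbabilityMeasure μ] {a x : ℝ}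
    (hax : a ≤ x) :
    ∫ y, fejer y * μ.real (Set.Ico (a - y) (x - y)) = ∫ w, (∫ u in a..x, fejer (u - w)) ∂μ := by
  have hmeas : Measurable (fun p : ℝ × ℝ => (Set.Ico a x).indicator (1 : ℝ → ℝ) (p.2 + p.1)) :=
    (measurable_one.indicator measurableSet_Ico).comp (measurable_snd.add measurable_fst)
  have hint : Integrable (Function.uncurry fun y w : ℝ =>
      fejer y * (Set.Ico a x).indicator (1 : ℝ → ℝ) (w + y)) (volume.prod μ) := by
    refine Integrable.mono' (integrable_fejer.comp_fst μ)
      ((continuous_fejer.measurable.comp measurable_fst).mul hmeas).aestronglyMeasurable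
      (.of_forall fun p => ?_)
    simp only [Function.uncurry]
    rw [Real.norm_eq_abs, abs_mul, abs_of_nonneg (fejer_nonneg _)]
    refine mul_le_of_le_one_right (fejer_nonneg _) ?_
    by_cases h : p.2 + p.1 ∈ Set.Ico a x <;> simp [h]
  calc _ = ∫ y, ∫ w, fejer y * (Set.Ico a x).indicator (1 : ℝ → ℝ) (w + y) ∂μ := by
        congr 1
        ext y
        rw [integral_const_mul, ← integral_indicator_one measurableSet_Ico]
        congr 2
        ext w
        have : w ∈ Set.Ico (a - y) (x - y) ↔ w + y ∈ Set.Ico a x := by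
          simp only [Set.mem_Ico, sub_le_iff_le_add, lt_sub_iff_add_lt]
        by_cases h : w + y ∈ Set.Ico a x
        · simp [h, this.2 h]
        · simp [h, mt this.1 h]
    _ = ∫ w, (∫ y, fejer y * (Set.Ico a x).indicator (1 : ℝ → ℝ) (w + y)) ∂μ :=
        integral_integral_swap hint
    _ = _ := by
        congr 1
        ext w
        rw [← integral_sub_right_eq_self _ w, intervalIntegral.integral_of_le hax,
          ← integral_Ico_eq_integral_Ioc, ← integral_indicator measurableSet_Ico]
        congr 1
        ext u
        by_cases h : u ∈ Set.Ico a x <;> simp [h]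

open Complex in
lemma integral_fejer_sub_eq {a x : ℝ} (hax : a ≤ x) (w : ℝ) :
    ((∫ u in a..x, fejer (u - w) : ℝ) : ℂ) = 1 / (2 * Real.pi) *
      ∫ t in (-1 : ℝ)..1, (triangle t : ℂ) * (∫ u in a..x, cexp (-(t * u : ℝ) * I))
        * cexp ((t * w : ℝ) * I) := by
  have hpi : (Real.pi : ℂ) ≠ 0 := by exact_mod_cast Real.pi_ne_zero
  have hcont : Continuous (Function.uncurry fun u t : ℝ =>
      (triangle t : ℂ) * cexp (-(t * (u - w) : ℝ) * I)) := by
    have := continuous_triangle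
    fun_prop
  have h1 : ∀ u, (fejer (u - w) : ℂ) = 1 / (2 * Real.pi) *
      ∫ t in (-1 : ℝ)..1, (triangle t : ℂ) * cexp (-(t * (u - w) : ℝ) * I) := fun u => by
    rw [integral_triangle_mul_cexp]; field_simp
  rw [← intervalIntegral.integral_ofReal]
  simp_rw [h1]
  rw [intervalIntegral.integral_const_mul]
  congr 1
  simp_rw [intervalIntegral.integral_of_le (show (-1 : ℝ) ≤ 1 by norm_num)]
  rw [intervalIntegral_integral_swap]
  · congr 1
    ext t
    rw [mul_assoc, intervalIntegral.integral_const_mul, ← intervalIntegral.integral_mul_const]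
    congr 2
    ext u
    rw [← Complex.exp_add]
    congr 1
    push_cast
    ring
  · have : IsFiniteMeasure ((volume : Measure ℝ).restrict (Set.uIoc a x)) :=
      ⟨by rw [Measure.restrict_apply_univ, Set.uIoc_of_le hax, Real.volume_Ioc]
          exact ENNReal.ofReal_lt_top⟩
    refine Integrable.mono' (integrable_const (1 : ℝ)) hcont.aestronglyMeasurable
      (.of_forall fun p => ?_)
    simp only [Function.uncurry]
    rw [norm_mul, ← ofReal_neg, norm_exp_ofReal_mul_I, mul_one, norm_real, Real.norm_eq_abs,
      abs_of_nonneg (triangle_nonneg _)]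
    exact triangle_le_one _

open Complex in
lemma integral_integral_fejer_sub_eq (μ : Measure ℝ) [IsProbabilityMeasure μ] {a x : ℝ}
    (hax : a ≤ x) :
    ((∫ w, (∫ u in a..x, fejer (u - w)) ∂μ : ℝ) : ℂ) = 1 / (2 * Real.pi) *
      ∫ t in (-1 : ℝ)..1, (triangle t : ℂ) * (∫ u in a..x, cexp (-(t * u : ℝ) * I))
        * charFun μ t := by
  rw [← integral_complex_ofReal]
  simp_rw [integral_fejer_sub_eq hax]
  rw [integral_const_mul]
  congr 1
  rw [← intervalIntegral_integral_swap]
  · refine intervalIntegral.integral_congr fun t _ => ?_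
    rw [integral_const_mul, charFun_apply_real]
    simp
  · have hθ : Continuous fun t : ℝ => ∫ u in a..x, cexp (-(t * u : ℝ) * I) :=
      intervalIntegral.continuous_parametric_intervalIntegral_of_continuous' (by fun_prop) a x
    have hcont : Continuous (Function.uncurry fun t w : ℝ =>
        (triangle t : ℂ) * (∫ u in a..x, cexp (-(t * u : ℝ) * I)) * cexp ((t * w : ℝ) * I)) := by
      have := continuous_triangle
      have := hθ.comp (continuous_fst (X := ℝ) (Y := ℝ))
      simp only [Function.uncurry_def]
      refine Continuous.mul (Continuous.mul (by fun_prop) this) (by fun_prop)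
    have : IsFiniteMeasure ((volume : Measure ℝ).restrict (Set.uIoc (-1) 1)) :=
      ⟨by rw [Measure.restrict_apply_univ, Set.uIoc_of_le (by norm_num), Real.volume_Ioc]
          exact ENNReal.ofReal_lt_top⟩
    refine Integrable.mono' (integrable_const (1 * (x - a))) hcont.aestronglyMeasurable
      (.of_forall fun p => ?_)
    simp only [Function.uncurry]
    rw [norm_mul, norm_exp_ofReal_mul_I, mul_one, norm_mul, norm_real, Real.norm_eq_abs,
      abs_of_nonneg (triangle_nonneg _)]
    gcongr
    · exact triangle_le_one _
    · have := intervalIntegral.norm_integral_le_of_norm_le_const (a := a) (b := x) (C := 1)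
        (f := fun u : ℝ => cexp (-(p.1 * u : ℝ) * I)) fun u _ => by
          rw [← ofReal_neg, norm_exp_ofReal_mul_I]
      rwa [one_mul, abs_of_nonneg (by linarith)] at this

-- The bound is uniform in both endpoints, so the left one can later go to -∞; the factor |t|
-- absorbs the one in the bound on the characteristic functions.
open Complex in
lemma abs_mul_norm_integral_cexp_le (a x t : ℝ) :
    |t| * ‖∫ u in a..x, cexp (-(t * u : ℝ) * I)‖ ≤ 2 := by
  rcases eq_or_ne t 0 with rfl | ht
  · simp
  · have hc : (-(t : ℂ) * I) ≠ 0 := by simp [ht]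
    have : ∀ u : ℝ, cexp (-(t * u : ℝ) * I) = cexp (-(t : ℂ) * I * u) := fun u => by
      congr 1; push_cast; ring
    simp_rw [this]
    rw [integral_exp_mul_complex hc, norm_div, norm_mul, norm_neg, norm_I, mul_one, norm_real,
      Real.norm_eq_abs, mul_div_cancel₀ _ (abs_pos.2 ht).ne']
    refine (norm_sub_le _ _).trans ?_
    rw [← this, ← this, ← ofReal_neg, ← ofReal_neg, norm_exp_ofReal_mul_I, norm_exp_ofReal_mul_I]
    norm_num

/-! ### Esseen's smoothing inequality -/

section Smoothing

variable (μ ν : Measure ℝ) [IsProbabilityMeasure μ] [IsProbabilityMeasure ν]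

lemma measurable_measureReal_Iio : Measurable fun x => μ.real (Set.Iio x) :=
  Monotone.measurable fun _ _ h => measureReal_mono (Set.Iio_subset_Iio h)

lemma integrable_fejer_mul_measureReal_Iio (x : ℝ) :
    Integrable fun y => fejer y * μ.real (Set.Iio (x - y)) := by
  refine Integrable.mono' integrable_fejer (Measurable.aestronglyMeasurable ?_)
    (.of_forall fun y => ?_)
  · exact continuous_fejer.measurable.mul
      ((measurable_measureReal_Iio μ).comp (measurable_const.sub measurable_id))
  · rw [Real.norm_eq_abs, abs_mul, abs_of_nonneg (fejer_nonneg _), abs_of_nonneg measureReal_nonneg]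
    exact mul_le_of_le_one_right (fejer_nonneg _) measureReal_le_one

lemma tendsto_integral_fejer_mul_measureReal_Iio :
    Filter.Tendsto (fun a => ∫ y, fejer y * μ.real (Set.Iio (a - y))) Filter.atBot (nhds 0) := by
  have : (0 : ℝ) = ∫ y : ℝ, (0 : ℝ) := by simp
  rw [this]
  refine tendsto_integral_filter_of_dominated_convergence fejer
    (.of_forall fun a => (integrable_fejer_mul_measureReal_Iio μ a).aestronglyMeasurable)
    (.of_forall fun a => .of_forall fun y => ?_) integrable_fejer (.of_forall fun y => ?_)
  · rw [Real.norm_eq_abs, abs_mul, abs_of_nonneg (fejer_nonneg _), abs_of_nonneg measureReal_nonneg]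
    exact mul_le_of_le_one_right (fejer_nonneg _) measureReal_le_one
  · rw [← mul_zero (fejer y)]
    refine Filter.Tendsto.const_mul _ ?_
    have h1 : Filter.Tendsto (fun a => cdf μ (a - y)) Filter.atBot (nhds 0) :=
      (tendsto_cdf_atBot μ).comp (Filter.tendsto_atBot_add_const_right _ (-y) Filter.tendsto_id)
    refine squeeze_zero (fun a => measureReal_nonneg) (fun a => ?_) h1
    rw [cdf_eq_real]
    exact measureReal_mono Set.Iio_subset_Iic_self

lemma measureReal_Ico_eq_sub {a x : ℝ} (hax : a ≤ x) :
    μ.real (Set.Ico a x) = μ.real (Set.Iio x) - μ.real (Set.Iio a) := by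
  rw [← measureReal_sdiff (Set.Iio_subset_Iio hax) measurableSet_Iio]
  congr 1
  ext y
  simp

open Complex in
/-- The difference of two distribution functions, smoothed by the Fejér kernel, is controlled by
the difference of the characteristic functions on `[-1, 1]`. -/
lemma abs_integral_fejer_mul_sub_le {φ : ℝ → ℝ} (hφ : IntervalIntegrable φ volume (-1) 1)
    (hφ0 : ∀ t, 0 ≤ φ t)
    (hle : ∀ t ∈ Set.Icc (-1 : ℝ) 1, ‖charFun μ t - charFun ν t‖ ≤ |t| * φ t) (x : ℝ) :
    |∫ y, fejer y * (μ.real (Set.Iio (x - y)) - ν.real (Set.Iio (x - y)))|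
      ≤ 1 / Real.pi * ∫ t in (-1 : ℝ)..1, φ t := by
  have hpi := Real.pi_pos
  set A : ℝ → ℝ := fun x => ∫ y, fejer y * (μ.real (Set.Iio (x - y)) - ν.real (Set.Iio (x - y)))
    with hA
  have hAeq : ∀ x, A x = (∫ y, fejer y * μ.real (Set.Iio (x - y)))
      - ∫ y, fejer y * ν.real (Set.Iio (x - y)) := fun x => by
    rw [← integral_sub (integrable_fejer_mul_measureReal_Iio μ x)
      (integrable_fejer_mul_measureReal_Iio ν x)]
    simp only [hA, mul_sub]
  have hdiff : ∀ a ≤ x, |A x - A a| ≤ 1 / Real.pi * ∫ t in (-1 : ℝ)..1, φ t := by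
    intro a hax
    have hIco : ∀ (ρ : Measure ℝ) [IsProbabilityMeasure ρ],
        (∫ y, fejer y * ρ.real (Set.Iio (x - y))) - ∫ y, fejer y * ρ.real (Set.Iio (a - y))
          = ∫ w, (∫ u in a..x, fejer (u - w)) ∂ρ := by
      intro ρ _
      rw [← integral_fejer_mul_measureReal_Ico ρ hax,
        ← integral_sub (integrable_fejer_mul_measureReal_Iio ρ x)
        (integrable_fejer_mul_measureReal_Iio ρ a)]
      congr 1
      ext y
      rw [measureReal_Ico_eq_sub ρ (by linarith), mul_sub]
    have e : A x - A a = (∫ w, (∫ u in a..x, fejer (u - w)) ∂μ)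
        - ∫ w, (∫ u in a..x, fejer (u - w)) ∂ν := by
      rw [hAeq, hAeq, ← hIco μ, ← hIco ν]; ring
    have hθ : Continuous fun t : ℝ => (triangle t : ℂ) * ∫ u in a..x, cexp (-(t * u : ℝ) * I) :=
      (continuous_ofReal.comp continuous_triangle).mul
        (intervalIntegral.continuous_parametric_intervalIntegral_of_continuous' (by fun_prop) a x)
    have hii : ∀ (ρ : Measure ℝ) [IsProbabilityMeasure ρ], IntervalIntegrable
        (fun t : ℝ => (triangle t : ℂ) * (∫ u in a..x, cexp (-(t * u : ℝ) * I)) * charFun ρ t)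
        volume (-1) 1 := fun ρ _ => intervalIntegrable_charFun.continuousOn_mul hθ.continuousOn
    have e' : ((A x - A a : ℝ) : ℂ) = 1 / (2 * Real.pi) * ∫ t in (-1 : ℝ)..1,
        (triangle t : ℂ) * (∫ u in a..x, cexp (-(t * u : ℝ) * I))
          * (charFun μ t - charFun ν t) := by
      rw [e, ofReal_sub, integral_integral_fejer_sub_eq μ hax, integral_integral_fejer_sub_eq ν hax,
        ← mul_sub, ← intervalIntegral.integral_sub (hii μ) (hii ν)]
      simp only [mul_sub]
    rw [← Real.norm_eq_abs, ← norm_real, e', norm_mul]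
    have hn : ‖(1 / (2 * Real.pi) : ℂ)‖ = 1 / (2 * Real.pi) := by
      simp [abs_of_pos hpi]
    have hb : ‖∫ t in (-1 : ℝ)..1, (triangle t : ℂ) * (∫ u in a..x, cexp (-(t * u : ℝ) * I))
        * (charFun μ t - charFun ν t)‖ ≤ ∫ t in (-1 : ℝ)..1, 2 * φ t := by
      refine intervalIntegral.norm_integral_le_of_norm_le (by norm_num)
        (.of_forall fun t ht => ?_) (hφ.const_mul 2)
      rw [norm_mul, norm_mul, norm_real, Real.norm_eq_abs, abs_of_nonneg (triangle_nonneg t)]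
      calc _ ≤ 1 * ‖∫ u in a..x, cexp (-(t * u : ℝ) * I)‖ * (|t| * φ t) := by
            gcongr
            · exact triangle_le_one t
            · exact hle t (Set.Ioc_subset_Icc_self ht)
        _ = (|t| * ‖∫ u in a..x, cexp (-(t * u : ℝ) * I)‖) * φ t := by ring
        _ ≤ _ := by
            gcongr
            · exact hφ0 t
            · exact abs_mul_norm_integral_cexp_le a x t
    rw [intervalIntegral.integral_const_mul] at hb
    rw [hn]
    calc _ ≤ 1 / (2 * Real.pi) * (2 * ∫ t in (-1 : ℝ)..1, φ t) := by gcongr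
      _ = _ := by field_simp
  -- The bound on increments does not depend on a, and the smoothed difference vanishes at -∞.
  have hlim : Filter.Tendsto (fun a => |A x - A a|) Filter.atBot (nhds |A x - 0|) := by
    refine (tendsto_const_nhds.sub ?_).abs
    rw [funext hAeq]
    simpa using (tendsto_integral_fejer_mul_measureReal_Iio μ).sub
      (tendsto_integral_fejer_mul_measureReal_Iio ν)
  rw [sub_zero] at hlim
  exact le_of_tendsto hlim ((Filter.eventually_le_atBot x).mono hdiff)

/-- Averaging against the Fejér kernel a function bounded below by `-Δ` everywhere and by an
affine function on `[-h, h]`. -/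
lemma le_integral_fejer_mul {g : ℝ → ℝ} {c s h Δ : ℝ} (hh : 0 ≤ h)
    (hint : Integrable fun y => fejer y * g y) (hΔ : ∀ y, -Δ ≤ g y)
    (hc : ∀ y ∈ Set.Icc (-h) h, c + s * y ≤ g y) :
    c * (∫ y in Set.Icc (-h) h, fejer y) - Δ * (1 - ∫ y in Set.Icc (-h) h, fejer y)
      ≤ ∫ y, fejer y * g y := by
  have hid : IntegrableOn (fun y => y * fejer y) (Set.Icc (-h) h) :=
    (continuous_id.mul continuous_fejer).continuousOn.integrableOn_Icc
  have h1 : c * ∫ y in Set.Icc (-h) h, fejer y ≤ ∫ y in Set.Icc (-h) h, fejer y * g y := by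
    calc _ = ∫ y in Set.Icc (-h) h, (c * fejer y + s * (y * fejer y)) := by
          rw [integral_add (integrable_fejer.integrableOn.const_mul c) (hid.const_mul s),
            integral_const_mul, integral_const_mul, integral_id_mul_fejer_Icc h hh, mul_zero,
            add_zero]
      _ ≤ _ := by
          refine setIntegral_mono_on
            ((integrable_fejer.integrableOn.const_mul c).add (hid.const_mul s))
            hint.integrableOn measurableSet_Icc fun y hy => ?_
          calc _ = fejer y * (c + s * y) := by ring
            _ ≤ _ := mul_le_mul_of_nonneg_left (hc y hy) (fejer_nonneg y)
  have hcompl : ∫ y in (Set.Icc (-h) h)ᶜ, fejer y = 1 - ∫ y in Set.Icc (-h) h, fejer y := by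
    rw [← integral_fejer, ← integral_add_compl measurableSet_Icc integrable_fejer]
    ring
  have h2 : -Δ * ∫ y in (Set.Icc (-h) h)ᶜ, fejer y ≤ ∫ y in (Set.Icc (-h) h)ᶜ, fejer y * g y := by
    rw [← integral_const_mul]
    refine setIntegral_mono_on (integrable_fejer.integrableOn.const_mul _) hint.integrableOn
      measurableSet_Icc.compl fun y _ => ?_
    rw [mul_comm]
    exact mul_le_mul_of_nonneg_left (hΔ y) (fejer_nonneg y)
  rw [← integral_add_compl (measurableSet_Icc (a := -h) (b := h)) hint]
  rw [hcompl] at h2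
  linarith

/-- Esseen's smoothing inequality. -/
theorem abs_measureReal_Iio_sub_le {M : ℝ} (hM : 0 < M)
    (hν : ∀ x s : ℝ, 0 ≤ s → ν.real (Set.Ico x (x + s)) ≤ M * s)
    {φ : ℝ → ℝ} (hφ : IntervalIntegrable φ volume (-1) 1) (hφ0 : ∀ t, 0 ≤ φ t)
    (hle : ∀ t ∈ Set.Icc (-1 : ℝ) 1, ‖charFun μ t - charFun ν t‖ ≤ |t| * φ t) (x : ℝ) :
    |μ.real (Set.Iio x) - ν.real (Set.Iio x)|
      ≤ 2 / Real.pi * (∫ t in (-1 : ℝ)..1, φ t) + 24 / Real.pi * M := by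
  have hpi := Real.pi_pos
  set D : ℝ → ℝ := fun x => μ.real (Set.Iio x) - ν.real (Set.Iio x) with hD
  set ε := 1 / Real.pi * ∫ t in (-1 : ℝ)..1, φ t with hε
  have hε0 : 0 ≤ ε :=
    mul_nonneg (by positivity) (intervalIntegral.integral_nonneg (by norm_num) fun t _ => hφ0 t)
  have hD1 : ∀ x, |D x| ≤ 1 := fun x => by
    have h1 := measureReal_le_one (μ := μ) (s := Set.Iio x)
    have h2 := measureReal_le_one (μ := ν) (s := Set.Iio x)
    have h3 := measureReal_nonneg (μ := μ) (s := Set.Iio x)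
    have h4 := measureReal_nonneg (μ := ν) (s := Set.Iio x)
    rw [abs_le]
    constructor <;> simp only [hD] <;> linarith
  have hbdd : BddAbove (Set.range fun x => |D x|) := ⟨1, by rintro _ ⟨x, rfl⟩; exact hD1 x⟩
  set Δ := ⨆ x, |D x| with hΔ
  have hDΔ : ∀ x, |D x| ≤ Δ := fun x => le_ciSup hbdd x
  have hint : ∀ x, Integrable fun y => fejer y * D (x - y) := fun x => by
    simp only [hD, mul_sub]
    exact (integrable_fejer_mul_measureReal_Iio μ x).sub (integrable_fejer_mul_measureReal_Iio ν x)
  have hA : ∀ x, |∫ y, fejer y * D (x - y)| ≤ ε := abs_integral_fejer_mul_sub_le μ ν hφ hφ0 hle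
  have hstep : ∀ x s, 0 ≤ s → D x - M * s ≤ D (x + s) := fun x s hs => by
    have h1 := hν x s hs
    rw [measureReal_Ico_eq_sub ν (by linarith)] at h1
    have h2 : μ.real (Set.Iio x) ≤ μ.real (Set.Iio (x + s)) :=
      measureReal_mono (Set.Iio_subset_Iio (by linarith))
    simp only [hD]
    linarith
  suffices h : Δ ≤ 2 * ε + 24 / Real.pi * M by
    refine (hDΔ x).trans (h.trans_eq ?_)
    rw [hε]; ring
  rcases le_or_gt Δ 0 with hΔ0 | hΔ0
  · exact hΔ0.trans (by positivity)
  -- With this window M h = Δ/2, so averaging loses half of Δ on the window and the tail term Δ(1 -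
  -- m) is at most 8M/π, whatever Δ is.
  set h := Δ / (2 * M) with hh
  have hh0 : 0 < h := by positivity
  set m := ∫ y in Set.Icc (-h) h, fejer y with hm
  have hm0 : 0 ≤ m := integral_nonneg fun y => fejer_nonneg y
  have hm1 : 1 - m ≤ 8 / Real.pi * M / Δ := by
    refine (one_sub_integral_fejer_Icc_le hh0).trans_eq ?_
    rw [hh]; field_simp; norm_num
  have hpt : ∀ x, |D x| * m ≤ ε + Δ * (1 - m) + M * h * m := by
    intro x
    rcases le_total 0 (D x) with h0 | h0
    · rw [abs_of_nonneg h0]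
      -- Centring at x + h places the window [x, x + 2h] to the right of x, where D falls with slope
      -- at most M. For negative D the window lies to the left.
      have := le_integral_fejer_mul (g := fun y => D (x + h - y)) (c := D x - M * h) (s := M)
        (Δ := Δ) hh0.le (hint (x + h)) (fun y => (abs_le.1 (hDΔ _)).1) (fun y hy => by
          have := hstep x (h - y) (by linarith [hy.2])
          rw [← add_sub_assoc] at this
          linarith)
      have h2 := (abs_le.1 (hA (x + h))).2
      linarith
    · rw [abs_of_nonpos h0]
      have := le_integral_fejer_mul (g := fun y => -D (x - h - y)) (c := -D x - M * h) (s := -M)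
        (Δ := Δ) hh0.le (by simpa using (hint (x - h)).neg)
        (fun y => neg_le_neg (abs_le.1 (hDΔ _)).2) (fun y hy => by
          have := hstep (x - h - y) (h + y) (by linarith [hy.1])
          have e : x - h - y + (h + y) = x := by ring
          rw [e] at this
          linarith)
      simp only [mul_neg, integral_neg] at this
      have h2 := (abs_le.1 (hA (x - h))).1
      linarith
  have hsup : Δ * m ≤ ε + Δ * (1 - m) + M * h * m := by
    rcases eq_or_lt_of_le hm0 with hm0 | hm0
    · rw [← hm0]; simp only [mul_zero, sub_zero, mul_one, add_zero]; linarith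
    · rw [← le_div_iff₀ hm0]
      exact ciSup_le fun x => by rw [le_div_iff₀ hm0]; exact hpt x
  have hMh : M * h = Δ / 2 := by rw [hh]; field_simp
  rw [hMh] at hsup
  have : Δ * (1 - m) ≤ 8 / Real.pi * M := by
    calc _ ≤ Δ * (8 / Real.pi * M / Δ) := by gcongr
      _ = _ := by field_simp
  have e24 : 24 / Real.pi * M = 3 * (8 / Real.pi * M) := by ring
  linarith

end Smoothing

/-! ### Gaussian densities, moments and scaling -/

lemma gaussianPDFReal_zero_eq (v : NNReal) (x : ℝ) :
    gaussianPDFReal 0 v x = (√(2 * Real.pi * v))⁻¹ * Real.exp (-(x ^ 2 / (2 * v))) := by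
  rw [gaussianPDFReal, sub_zero, neg_div]

lemma gaussianReal_Ico_le {v : NNReal} (hv : v ≠ 0) {x s : ℝ} (hs : 0 ≤ s) :
    (gaussianReal 0 v).real (Set.Ico x (x + s)) ≤ (√(2 * Real.pi * v))⁻¹ * s := by
  rw [measureReal_def, gaussianReal_apply_eq_integral 0 hv,
    ENNReal.toReal_ofReal (integral_nonneg fun y => gaussianPDFReal_nonneg _ _ _)]
  calc _ ≤ ∫ y in Set.Ico x (x + s), (√(2 * Real.pi * v))⁻¹ := by
        refine setIntegral_mono_on (integrable_gaussianPDFReal 0 v).integrableOn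
          (integrableOn_const (by simp)) measurableSet_Ico fun y _ => ?_
        rw [gaussianPDFReal_zero_eq]
        refine mul_le_of_le_one_right (by positivity) ?_
        rw [Real.exp_le_one_iff, neg_nonpos]
        positivity
    _ = _ := by
        rw [setIntegral_const, Real.volume_real_Ico, smul_eq_mul, max_eq_left (by linarith)]
        ring

/-- Up to normalisation this is the second moment of the centred Gaussian law of variance 2/T². -/
lemma integrable_and_integral_sq_mul_exp {T : ℝ} (hT : 0 < T) :
    Integrable (fun t : ℝ => t ^ 2 * Real.exp (-(T ^ 2 * t ^ 2 / 4))) ∧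
    ∫ t : ℝ, t ^ 2 * Real.exp (-(T ^ 2 * t ^ 2 / 4)) = 4 * √Real.pi / T ^ 3 := by
  have hpi := Real.pi_pos
  obtain ⟨v, hv⟩ : ∃ v : NNReal, (v : ℝ) = 2 / T ^ 2 := ⟨⟨2 / T ^ 2, by positivity⟩, rfl⟩
  have hv0 : v ≠ 0 := by
    rintro rfl
    have : 0 < 2 / T ^ 2 := by positivity
    rw [← hv] at this
    simp at this
  have hsqrt : √(2 * Real.pi * v) = 2 * √Real.pi / T := by
    rw [hv, show 2 * Real.pi * (2 / T ^ 2) = (2 / T) ^ 2 * Real.pi by ring,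
      Real.sqrt_mul (by positivity), Real.sqrt_sq (by positivity)]
    ring
  have hpdf : ∀ t : ℝ, t ^ 2 * Real.exp (-(T ^ 2 * t ^ 2 / 4))
      = (2 * √Real.pi / T) * (gaussianPDFReal 0 v t * t ^ 2) := fun t => by
    rw [gaussianPDFReal_zero_eq, hsqrt, hv]
    have : t ^ 2 / (2 * (2 / T ^ 2)) = T ^ 2 * t ^ 2 / 4 := by field_simp; norm_num
    rw [this]
    field_simp
  have hint : ∫ t, gaussianPDFReal 0 v t * t ^ 2 = v := by
    have h1 := variance_fun_id_gaussianReal (μ := 0) (v := v)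
    rw [variance_eq_integral (by fun_prop), integral_id_gaussianReal,
      integral_gaussianReal_eq_integral_smul hv0] at h1
    simpa using h1
  -- A non-integrable function would have integral 0 by convention, but the value just found is v ≠
  -- 0.
  have hi : Integrable fun t => gaussianPDFReal 0 v t * t ^ 2 := by
    by_contra h
    rw [integral_undef h] at hint
    exact hv0 (by exact_mod_cast hint.symm)
  simp_rw [hpdf]
  refine ⟨hi.const_mul _, ?_⟩
  rw [integral_const_mul, hint, hv]
  field_simp
  norm_num

lemma stdNormalCDF_eq {T : ℝ} (hT : 0 < T) (x : ℝ) :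
    stdNormalCDF x = (gaussianReal 0 ⟨T ^ 2, sq_nonneg T⟩).real (Set.Iio (T * x)) := by
  have h := gaussianReal_map_const_mul (μ := 0) (v := 1) T
  rw [mul_zero, mul_one] at h
  have : NullSingletonClass (gaussianReal 0 1) :=
    nullSingletonClass_gaussianReal one_ne_zero
  rw [stdNormalCDF, cdf_eq_real, measureReal_congr Iio_ae_eq_Iic.symm]
  change _ = (gaussianReal 0 (NNReal.mk (T ^ 2) (sq_nonneg T))).real _
  rw [← h, map_measureReal_apply (by fun_prop) measurableSet_Iio]
  congr 1
  ext y
  simp only [Set.mem_preimage, Set.mem_Iio]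
  rw [mul_lt_mul_iff_right₀ hT]

/-! ### Rescaling and the final constant -/

section Main

variable {Ω : Type u} [MeasurableSpace Ω] {P : Measure Ω} [IsProbabilityMeasure P]
  {n : ℕ} {X : Fin n → Ω → ℝ}

lemma sum_integral_abs_cube_pos (hX : ∀ k, Measurable (X k))
    (h3 : ∀ k, Integrable (fun ω => |X k ω| ^ 3) P) (hV : 0 < varSum P X) :
    0 < ∑ k, ∫ ω, |X k ω| ^ 3 ∂P := by
  have hnonneg : ∀ k, 0 ≤ ∫ ω, |X k ω| ^ 3 ∂P := fun k =>
    integral_nonneg fun ω => by positivity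
  obtain ⟨k, _, hk⟩ := Finset.exists_lt_of_sum_lt (s := Finset.univ) (f := fun _ : Fin n => (0 : ℝ))
    (g := fun k => ∫ ω, X k ω ^ 2 ∂P) (by simpa [varSum] using hV)
  refine Finset.sum_pos' (fun k _ => hnonneg k) ⟨k, Finset.mem_univ k, ?_⟩
  refine lt_of_lt_of_le ?_ (sqrt_integral_sq_cube_le (hX k) (h3 k))
  have := Real.sqrt_pos.2 hk
  positivity

/-- The Berry–Esseen inequality with the constant `4 / √π + 36 / (π √(2π)) = 6.82…`. -/
lemma kolmogorovDist_le_of_explicit_constant (hX : ∀ k, Measurable (X k)) (hind : iIndepFun X P)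
    (h3 : ∀ k, Integrable (fun ω => |X k ω| ^ 3) P) (h0 : ∀ k, ∫ ω, X k ω ∂P = 0)
    (hV : 0 < varSum P X) :
    kolmogorovDist P X
      ≤ (4 / √Real.pi + 36 / (Real.pi * √(2 * Real.pi))) * lyapunovRatio P X := by
  have hpi := Real.pi_pos
  have hρ := sum_integral_abs_cube_pos hX h3 hV
  set ρ := ∑ k, ∫ ω, |X k ω| ^ 3 ∂P with hρdef
  set B := normalizer P X with hB
  have hB0 : 0 < B := Real.sqrt_pos.2 hV
  have hB2 : varSum P X = B ^ 2 := (Real.sq_sqrt hV.le).symm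
  set L := lyapunovRatio P X with hL
  have hLρ : ρ = L * B ^ 3 := by
    rw [hL, lyapunovRatio, ← hB, ← hρdef]; field_simp
  have hL0 : 0 < L := by
    by_contra h
    have : L * B ^ 3 ≤ 0 := mul_nonpos_of_nonpos_of_nonneg (not_lt.1 h) (by positivity)
    linarith
  -- For |t| ≤ 1, T L = 2/3 bounds the cubic term (3/8)T³L|t|³ by T²t²/4, half of the Gaussian
  -- exponent, so the damping exp(-T²t²/4) survives. Scaling by T/B moves the frequency window [-T,
  -- T] to [-1, 1].
  obtain ⟨T, hT, hTL⟩ : ∃ T : ℝ, 0 < T ∧ T * L = 2 / 3 := ⟨2 / 3 / L, by positivity, by field_simp⟩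
  have hS : Measurable (partialSum X) := by
    unfold partialSum; exact Finset.measurable_sum _ fun k _ => hX k
  have hTS : Measurable fun ω => T / B * partialSum X ω := hS.const_mul _
  have : IsProbabilityMeasure (P.map fun ω => T / B * partialSum X ω) :=
    Measure.isProbabilityMeasure_map hTS.aemeasurable
  let v : NNReal := ⟨T ^ 2, sq_nonneg T⟩
  have hvT : (v : ℝ) = T ^ 2 := rfl
  have hv0 : v ≠ 0 := by
    intro h
    have : (v : ℝ) = 0 := by rw [h]; rfl
    rw [hvT] at this
    exact hT.ne' (by simpa using this)
  obtain ⟨hexpint, hexp⟩ := integrable_and_integral_sq_mul_exp hT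
  set φ : ℝ → ℝ := fun t => L * T ^ 3 / 2 * (t ^ 2 * Real.exp (-(T ^ 2 * t ^ 2 / 4))) with hφ
  have hφ0 : ∀ t, 0 ≤ φ t := fun t => by positivity
  have hφint : Integrable φ := hexpint.const_mul _
  have hφle : ∫ t in (-1 : ℝ)..1, φ t ≤ 2 * √Real.pi * L := by
    rw [intervalIntegral.integral_of_le (by norm_num)]
    refine (setIntegral_le_integral hφint (.of_forall hφ0)).trans_eq ?_
    rw [hφ, integral_const_mul, hexp]
    field_simp
    norm_num
  have hchar : ∀ t ∈ Set.Icc (-1 : ℝ) 1,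
      ‖charFun (P.map fun ω => T / B * partialSum X ω) t - charFun (gaussianReal 0 v) t‖
        ≤ |t| * φ t := by
    intro t ht
    have ht1 : |t| ≤ 1 := abs_le.2 ht
    rw [charFun_map_mul_comp hS.aemeasurable, charFun_gaussianReal]
    have h := norm_charFun_sum_sub_gaussian_le hX hind h3 h0 (T / B * t)
    have e1 : (T / B * t) ^ 2 * varSum P X = T ^ 2 * t ^ 2 := by rw [hB2]; field_simp
    have e2 : |T / B * t| ^ 3 * ρ = T ^ 3 * L * |t| ^ 3 := by
      rw [hLρ, abs_mul, abs_of_pos (by positivity : 0 < T / B)]; field_simp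
    have e3 : ((Real.exp (-(T ^ 2 * t ^ 2 / 2)) : ℝ) : ℂ)
        = Complex.exp (t * (0 : ℝ) * Complex.I - (v : ℝ) * t ^ 2 / 2) := by
      rw [hvT]; push_cast; congr 1; ring
    rw [← hρdef, e1, e2, e3] at h
    refine h.trans ?_
    have hcube : |t| ^ 3 ≤ t ^ 2 := by
      rw [← sq_abs]; exact pow_le_pow_of_le_one (abs_nonneg t) ht1 (by norm_num)
    have hexple : -(T ^ 2 * t ^ 2 / 2 - 3 / 8 * (T ^ 3 * L * |t| ^ 3)) ≤ -(T ^ 2 * t ^ 2 / 4) := by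
      have : T ^ 3 * L * |t| ^ 3 = 2 / 3 * (T ^ 2 * |t| ^ 3) := by rw [← hTL]; ring
      rw [this]
      have : T ^ 2 * |t| ^ 3 ≤ T ^ 2 * t ^ 2 := by gcongr
      linarith
    calc _ ≤ T ^ 3 * L * |t| ^ 3 / 2 * Real.exp (-(T ^ 2 * t ^ 2 / 4)) := by gcongr
      _ = _ := by rw [hφ]; simp only; rw [← sq_abs t]; ring
  refine ciSup_le fun x => ?_
  have hmain := abs_measureReal_Iio_sub_le (P.map fun ω => T / B * partialSum X ω)
    (gaussianReal 0 v) (M := (√(2 * Real.pi * v))⁻¹) (by rw [hvT]; positivity)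
    (fun x s hs => gaussianReal_Ico_le hv0 hs) hφint.intervalIntegrable hφ0 hchar (T * x)
  have hset : (P.map fun ω => T / B * partialSum X ω).real (Set.Iio (T * x))
      = P.real {ω | partialSum X ω < x * B} := by
    rw [map_measureReal_apply hTS measurableSet_Iio]
    congr 1
    ext ω
    simp only [Set.mem_preimage, Set.mem_Iio, Set.mem_ofPred_eq]
    rw [div_mul_eq_mul_div, div_lt_iff₀ hB0, mul_assoc, mul_lt_mul_iff_right₀ hT]
  rw [hset, ← stdNormalCDF_eq hT] at hmain
  refine hmain.trans ?_
  have hs : √(2 * Real.pi * v) = √(2 * Real.pi) * T := by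
    rw [hvT, Real.sqrt_mul (by positivity), Real.sqrt_sq hT.le]
  have hinv : T⁻¹ = 3 / 2 * L := by
    rw [inv_eq_one_div, div_eq_iff hT.ne']; linarith
  have hs0 : 0 < √(2 * Real.pi) := by positivity
  have hpis : Real.pi = √Real.pi ^ 2 := (Real.sq_sqrt hpi.le).symm
  have hps : 0 < √Real.pi := by positivity
  rw [hs, mul_inv, hinv]
  calc _ ≤ 2 / Real.pi * (2 * √Real.pi * L) + 24 / Real.pi * ((√(2 * Real.pi))⁻¹ * (3 / 2 * L)) := by
        gcongr
    _ = _ := by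
        have : 2 / Real.pi * (2 * √Real.pi * L) = 4 / √Real.pi * L := by
          nth_rewrite 1 [hpis]
          field_simp
          norm_num
        rw [this, add_mul]
        congr 1
        field_simp
        norm_num

/-- Coarse bounds suffice, since the left side is about 6.83; 8.23 is the proved lower bound for
`C₀`. -/
lemma explicit_constant_le : 4 / √Real.pi + 36 / (Real.pi * √(2 * Real.pi)) ≤ 8.23 := by
  have hp := Real.pi_gt_d2
  have h1 : 1.77 ≤ √Real.pi := by
    apply Real.le_sqrt_of_sq_le; norm_num at *; linarith
  have h2 : 2.5 ≤ √(2 * Real.pi) := by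
    apply Real.le_sqrt_of_sq_le; norm_num at *; linarith
  calc 4 / √Real.pi + 36 / (Real.pi * √(2 * Real.pi))
        ≤ 4 / 1.77 + 36 / (3.14 * 2.5 : ℝ) := by gcongr
    _ ≤ 8.23 := by norm_num

theorem kolmogorovDist_le (hX : ∀ k, Measurable (X k)) (hind : iIndepFun X P)
    (h3 : ∀ k, Integrable (fun ω => |X k ω| ^ 3) P) (h0 : ∀ k, ∫ ω, X k ω ∂P = 0)
    (hV : 0 < varSum P X) : kolmogorovDist P X ≤ C₀ * lyapunovRatio P X := by
  refine (kolmogorovDist_le_of_explicit_constant hX hind h3 h0 hV).trans (mul_le_mul_of_nonneg_right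
    (explicit_constant_le.trans exists_unique_minimizer_and_bounds.2.1) ?_)
  refine mul_nonneg ?_ (sum_integral_abs_cube_pos hX h3 hV).le
  have : 0 ≤ normalizer P X := Real.sqrt_nonneg _
  positivity

end Main

end BerryEsseen

theorem mainTheorem1 :
    -- the Berry–Esseen inequality with the absolute constant `C₀`
    (∀ (Ω : Type u) [MeasurableSpace Ω] (P : Measure Ω) [IsProbabilityMeasure P]
        (n : ℕ) (X : Fin n → Ω → ℝ),
        (∀ k, Measurable (X k)) →
        iIndepFun X P →
        (∀ k, Integrable (fun ω => |X k ω| ^ 3) P) →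
        (∀ k, ∫ ω, X k ω ∂P = 0) →
        0 < BerryEsseen.varSum P X →
        BerryEsseen.kolmogorovDist P X ≤ BerryEsseen.C₀ * BerryEsseen.lyapunovRatio P X) ∧
    -- the explicit bound given by `b = 2`, `d = 3/4`
    2 / √(2 * Real.pi) * BerryEsseen.objective (2, 3 / 4)
      = 8 / √(2 * Real.pi) * (√2 + 4 / Real.pi) ∧
    BerryEsseen.C₀ ≤ 8 / √(2 * Real.pi) * (√2 + 4 / Real.pi) ∧
    8.57 ≤ 8 / √(2 * Real.pi) * (√2 + 4 / Real.pi) ∧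
    8 / √(2 * Real.pi) * (√2 + 4 / Real.pi) < 8.58 ∧
    BerryEsseen.C₀ < 9 ∧
    -- the optimal parameters `b = 1.72…`, `d = 0.703…` and the value `C₀ = 8.23…`
    (∃ q ∈ BerryEsseen.paramSet,
      IsMinOn BerryEsseen.objective BerryEsseen.paramSet q ∧
      (∀ q' ∈ BerryEsseen.paramSet,
        IsMinOn BerryEsseen.objective BerryEsseen.paramSet q' → q' = q) ∧
      1.72 ≤ q.1 ∧ q.1 < 1.73 ∧ 0.703 ≤ q.2 ∧ q.2 < 0.704) ∧
    8.23 ≤ BerryEsseen.C₀ ∧ BerryEsseen.C₀ < 8.24 := by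
  obtain ⟨hmin, hlo, hhi⟩ := BerryEsseen.exists_unique_minimizer_and_bounds
  obtain ⟨he1, he2⟩ := BerryEsseen.explicit_bounds
  refine ⟨fun Ω _ P _ n X hX hind h3 h0 hV =>
    BerryEsseen.kolmogorovDist_le hX hind h3 h0 hV, BerryEsseen.objective_two_three_quarters,
    ?_, he1, he2, ?_, hmin, hlo, hhi⟩ <;> linarith
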